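/- Let $p$ be a probability kernel on $\mathbb Z$ with $p(0)\neq 1$ and, for some $\delta>0$, $\sum_{x}e^{\theta x}p(x)<\infty$ for $|\theta|\le\delta$; put $v=\sum_x xp(x)$ and $\kappa_2=\sum_x x^2p(x)$. Let $\nu$ be a probability law on $\{0,1,2,\dots\}$ with $\nu\ne\delta_0$ and $\gamma(\theta)=\log\sum_k e^{\theta k}\nu(k)<\infty$ for all $\theta\in\mathbb R$. For each $n$, let the initial occupation numbers $\eta^n_0(m)$, $m\in\mathbb Z$, be i.i.d. with law $\nu$, and let the particles move as independent continuous-time random walks (jumps at rate one with jump law $p$), where $X_{m,j}(\cdot)$ is the $j$-th walk started at site $m$ and the displacements $X_{m,j}(\cdot)-X_{m,j}(0)$ are i.i.d. and independent of $\eta^n_0$. For $r\in\mathbb R$ and $t>0$ let $$Y_n(t,r)=\sum_{m\in\mathbb Z}\sum_{j=1}^{\eta^n_0(m)}\Big[\mathbf 1\{X_{m,j}(nt)\le\lfloor nvt\rfloor+\lfloor r\sqrt n\rfloor,\ m>\lfloor r\sqrt n\rfloor\}-\mathbf 1\{X_{m,j}(nt)>\lfloor nvt\rfloor+\lfloor r\sqrt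 n\rfloor,\ m\le\lfloor r\sqrt n\rfloor\}\Big],$$ a series that converges absolutely almost surely. Let $\Phi=\Phi_{\kappa_2t}$ be the distribution function of the centered Gaussian law with variance $\kappa_2t$. For $\lambda,a,y\in\mathbb R$ let $$Z_\lambda(y)=\begin{cases}\log\{\Phi(y)+e^{\lambda}(1-\Phi(y))\},&y>0,\\ \log\{e^{-\lambda}\Phi(y)+1-\Phi(y)\},&y\le0,\end{cases}\qquad F_a(y)=\frac{e^{-a}\Phi(y)}{1-\Phi(y)+e^{-a}\Phi(y)},$$ $$\Lambda(\lambda)=\int_{-\infty}^{\infty}\gamma(Z_\lambda(y))\,dy,\qquad \gamma^*(u)=\sup_{\theta\in\mathbb R}\{\theta u-\gamma(\theta)\},\qquad Br_q^*(u)=u\log\frac uq+(1-u)\log\frac{1-u}{1-q}.$$ Then $\Lambda$ is finite and differentiable on $\mathbb R$; for every $x\in\mathbb R$ the equation $x=\Lambda'(a)$ has a unique solution $a=\alpha(x)$; and the integrals $$I_1(x)=\int_{-\infty}^\infty\gamma^*\big(\gamma'(Z_{\alpha(x)}(y))\big)\,dy,\qquad I_2(x)=\int_{-\infty}^\infty\gamma'(Z_{\alpha(x)}(y))\,Br^*_{\Phi(y)}\big(F_{\alpha(x)}(y)\big)\,dy$$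 converge, with the integrands finite. The function $I=I_1+I_2$ satisfies $I(x)=\sup_{\lambda\in\mathbb R}\{\lambda x-\Lambda(\lambda)\}$ for every $x\in\mathbb R$, is nonnegative and strictly convex, and has compact level sets. For each fixed $r\in\mathbb R$ and $t>0$, $n^{-1/2}Y_n(t,r)$ satisfies the large deviation principle with normalization $\sqrt n$ and rate function $I$: $$\limsup_{n\to\infty}\frac1{\sqrt n}\log P\{n^{-1/2}Y_n(t,r)\in F\}\le-\inf_{x\in F}I(x)\quad\text{for every closed }F\subset\mathbb R,$$ $$\liminf_{n\to\infty}\frac1{\sqrt n}\log P\{n^{-1/2}Y_n(t,r)\in G\}\ge-\inf_{x\in G}I(x)\quad\text{for every open }G\subset\mathbb R.$$ -/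

import Mathlib

open MeasureTheory ProbabilityTheory Filter Topology Set
open scoped NNReal ENNReal

noncomputable section

namespace CurrentLDP

/-! ### Continuous-time random walks on the integers -/

/-- The `k`-fold convolution power of `p`: the law of the sum of `k` independent jumps. -/
def stepPMF (p : PMF ℤ) : ℕ → PMF ℤ
  | 0 => PMF.pure 0
  | k + 1 => (stepPMF p k).bind fun x => p.map fun y => x + y

/-- The transition law over a time `h`, started at the origin, of the walk which jumps at rate one
with jump distribution `p`: a compound Poisson law. -/
def walkLaw (p : PMF ℤ) (h : ℝ≥0) : Measure ℤ :=
  (poissonMeasure h).bind fun k => (stepPMF p k).toMeasure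

/-- `X` is a continuous-time random walk with jump kernel `p` and total jump rate one started at
`m`: independent stationary increments with the compound Poisson laws, and cadlag paths. -/
structure IsRandomWalk {Ω : Type*} [MeasurableSpace Ω] (P : Measure Ω) (p : PMF ℤ) (m : ℤ)
    (X : ℝ≥0 → Ω → ℤ) : Prop where
  measurable : ∀ t, Measurable (X t)
  start : ∀ᵐ ω ∂P, X 0 ω = m
  indep_increments : HasIndepIncrements X P
  increment_law : ∀ s h : ℝ≥0, HasLaw (fun ω => X (s + h) ω - X s ω) (walkLaw p h) P
  cadlag : ∀ᵐ ω ∂P, ∀ t : ℝ≥0, ContinuousWithinAt (fun s => X s ω) (Ici t) t ∧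
    ∃ l : ℤ, Tendsto (fun s => X s ω) (𝓝[<] t) (𝓝 l)

/-- A system of independent random walks with i.i.d. initial occupation numbers of law `ν`:
`η m` is the number of particles initially at `m`, and `X m j` for `j < η m` are the trajectories
of these particles. The displacements are i.i.d. over all particles and independent of `η`. -/
structure IsWalkSystem {Ω : Type*} [MeasurableSpace Ω] (P : Measure Ω) (p : PMF ℤ)
    (ν : Measure ℕ) (η : ℤ → Ω → ℕ) (X : ℤ → ℕ → ℝ≥0 → Ω → ℤ) : Prop where
  occ_measurable : ∀ m, Measurable (η m)
  occ_law : ∀ m, HasLaw (η m) ν P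
  occ_indep : iIndepFun η P
  walk : ∀ m j, IsRandomWalk P p m (X m j)
  walk_indep : iIndepFun (fun (i : ℤ × ℕ) (ω : Ω) (t : ℝ≥0) => X i.1 i.2 t ω - X i.1 i.2 0 ω) P
  occ_walk_indep : IndepFun (fun (ω : Ω) (m : ℤ) => η m ω)
    (fun (ω : Ω) (i : ℤ × ℕ) (t : ℝ≥0) => X i.1 i.2 t ω - X i.1 i.2 0 ω) P

/-- The mean `v` of the jump kernel. -/
def jumpMean (p : PMF ℤ) : ℝ := ∑' x : ℤ, (x : ℝ) * (p x).toReal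

/-- The second moment `κ₂` of the jump kernel. -/
def jumpSecondMoment (p : PMF ℤ) : ℝ := ∑' x : ℤ, (x : ℝ) ^ 2 * (p x).toReal

/-! ### The current -/

/-- The contribution to the current of the particles initially at `m`: the number of those that
started strictly right of the characteristic and end weakly left of it, minus the number of those
that started weakly left of it and end strictly right of it. Here `η` is the realized initial
configuration and `X` are the realized trajectories. -/
def siteCurrent (v : ℝ) (η : ℤ → ℕ) (X : ℤ → ℕ → ℝ≥0 → ℤ) (n : ℕ) (t : ℝ≥0) (r : ℝ) (m : ℤ) : ℝ :=
  ∑ j ∈ Finset.range (η m),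
    ((if X m j (n * t) ≤ ⌊(n : ℝ) * v * t⌋ + ⌊r * √(n : ℝ)⌋ ∧ ⌊r * √(n : ℝ)⌋ < m
        then (1 : ℝ) else 0) -
      (if ⌊(n : ℝ) * v * t⌋ + ⌊r * √(n : ℝ)⌋ < X m j (n * t) ∧ m ≤ ⌊r * √(n : ℝ)⌋
        then (1 : ℝ) else 0))

/-- The net right-to-left current `Y_n(t, r)` across the characteristic line of slope `v`
started at `⌊r √n⌋`, during the time interval `[0, n t]`. -/
def current (v : ℝ) (η : ℤ → ℕ) (X : ℤ → ℕ → ℝ≥0 → ℤ) (n : ℕ) (t : ℝ≥0) (r : ℝ) : ℝ :=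
  ∑' m : ℤ, siteCurrent v η X n t r m

/-! ### Large deviation principle -/

/-- The large deviation principle for real random variables `Y n` (each on its own probability
space) with normalization `a` and rate function `J`. The infimum over the empty set is `⊤` and
`ENNReal.log 0 = ⊥`. -/
def SatisfiesLDP {Ω : ℕ → Type*} [∀ n, MeasurableSpace (Ω n)] (P : ∀ n, Measure (Ω n))
    (Y : ∀ n, Ω n → ℝ) (a : ℕ → ℝ) (J : ℝ → ℝ) : Prop :=
  (∀ F : Set ℝ, IsClosed F →
    limsup (fun n => ((1 / a n : ℝ) : EReal) * ENNReal.log (P n {ω | Y n ω ∈ F})) atTop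
      ≤ -(⨅ x ∈ F, (J x : EReal))) ∧
  (∀ G : Set ℝ, IsOpen G →
    -(⨅ x ∈ G, (J x : EReal))
      ≤ liminf (fun n => ((1 / a n : ℝ) : EReal) * ENNReal.log (P n {ω | Y n ω ∈ G})) atTop)

/-- A good rate function: nonnegative with compact level sets. -/
def IsGoodRate (J : ℝ → ℝ) : Prop :=
  (∀ x, 0 ≤ J x) ∧ ∀ c : ℝ, IsCompact {x | J x ≤ c}

/-! ### The rate function -/

/-- The logarithmic moment generating function `γ` of the occupation law `ν`. -/
def occCGF (ν : Measure ℕ) (θ : ℝ) : ℝ := Real.log (∫ k : ℕ, Real.exp (θ * k) ∂ν)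

/-- The convex dual `f*(x) = sup_θ (θ x - f θ)` (meaningful where the supremum is finite). -/
def convexDual (f : ℝ → ℝ) (x : ℝ) : ℝ := ⨆ θ : ℝ, (θ * x - f θ)

/-- The centered Gaussian distribution function with variance `s`. -/
def gaussCDF (s : ℝ≥0) (y : ℝ) : ℝ := ∫ u in Iic y, gaussianPDFReal 0 s u

/-- The function `Z_l(y)`, for variance `s`. -/
def Zfun (s : ℝ≥0) (l y : ℝ) : ℝ :=
  if 0 < y then Real.log (gaussCDF s y + Real.exp l * (1 - gaussCDF s y))
  else Real.log (Real.exp (-l) * gaussCDF s y + (1 - gaussCDF s y))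

/-- `Λ(l) = ∫ γ(Z_l(y)) dy`. -/
def Lam (g : ℝ → ℝ) (s : ℝ≥0) (l : ℝ) : ℝ := ∫ y : ℝ, g (Zfun s l y)

/-- The tilted probability `F_a(y)`. -/
def tiltF (s : ℝ≥0) (a y : ℝ) : ℝ :=
  Real.exp (-a) * gaussCDF s y / (1 - gaussCDF s y + Real.exp (-a) * gaussCDF s y)

/-- The Bernoulli relative entropy `Br_q*(x)`. -/
def bernoulliDual (q x : ℝ) : ℝ :=
  x * Real.log (x / q) + (1 - x) * Real.log ((1 - x) / (1 - q))

/-- The integrand of `I₁`, at tilt `a`. -/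
def density1 (g : ℝ → ℝ) (s : ℝ≥0) (a y : ℝ) : ℝ := convexDual g (deriv g (Zfun s a y))

/-- The integrand of `I₂`, at tilt `a`. -/
def density2 (g : ℝ → ℝ) (s : ℝ≥0) (a y : ℝ) : ℝ :=
  deriv g (Zfun s a y) * bernoulliDual (gaussCDF s y) (tiltF s a y)

/-- The sum of the integrals of the two cost densities, as a function of the tilt `a`. -/
def rateAtTilt (g : ℝ → ℝ) (s : ℝ≥0) (a : ℝ) : ℝ :=
  (∫ y : ℝ, density1 g s a y) + ∫ y : ℝ, density2 g s a y

end CurrentLDP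

end

noncomputable section

namespace CurrentLDP

/-! ### Convex duality for a differentiable function with strictly increasing derivative -/

/-! The proof is the Gärtner–Ellis method, with every exponential moment of the current computed
exactly. Given the initial configuration, the particles at one site all contribute with the same
sign and cross independently with a probability `q` depending only on their distance from the
characteristic. Averaging first over the walks and then over the occupation number, a site
contributes `γ(log(1 + (e^{±l} - 1) q))` to `log E exp(l Y_n)`, and the sites are independent
(`IsWalkSystem.lintegral_exp_sum`, extended to infinitely many sites by `integral_exp_tsum`).

Divided by `√n`, the sum over sites is a Riemann sum of mesh `1/√n`. The central limit theorem sends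
the crossing probability from distance `√n y` to a Gaussian tail, and Chebyshev's inequality
dominates it by a multiple of `1/(1 + y²)`; hence the scaled logarithmic moment generating functions
converge to `Λ` (`IsRandomWalk.tendsto_tsum_div_sqrt`).

`Λ` is differentiable, and `Λ'` is strictly increasing and onto the line. Every `x` is therefore
exposed by a unique tilt `α(x)`, so that Chernoff bounds and a change of measure give the two halves
of the principle (`satisfiesLDP_of_tendsto_cgf`) with rate `α(x) x - Λ(α(x))`. Strict convexity and
goodness are general facts about such a dual.

The formula `I₁ + I₂` is pointwise duality under the integral. With `Z = Z_a(y)` the first density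
is `Z γ'(Z) - γ(Z)`, while the second, a Bernoulli relative entropy weighted by `γ'(Z)`, is `a ∂_a
γ(Z) - Z γ'(Z)`. The terms `Z γ'(Z)` cancel, and integration leaves `a Λ'(a) - Λ(a)`
(`rateAtTilt_eq`). -/

/-- By the mean value theorem the slope of `Λ` between `l` and `a` is a value of `D` strictly
between the endpoints, so `Λ` lies strictly above its tangent at `a`. -/
lemma mul_sub_lt_of_strictMono_deriv {Λ D : ℝ → ℝ} (hΛ : ∀ l, HasDerivAt Λ (D l) l)
    (hD : StrictMono D) {a l : ℝ} (h : l ≠ a) : l * D a - Λ l < a * D a - Λ a := by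
  rcases lt_or_gt_of_ne h with h | h
  · obtain ⟨c, hc, hc'⟩ := exists_hasDerivAt_eq_slope Λ D h
      (fun z _ => (hΛ z).continuousAt.continuousWithinAt) (fun z _ => hΛ z)
    have h1 := hD hc.2
    rw [hc', div_lt_iff₀ (by linarith)] at h1
    linarith
  · obtain ⟨c, hc, hc'⟩ := exists_hasDerivAt_eq_slope Λ D h
      (fun z _ => (hΛ z).continuousAt.continuousWithinAt) (fun z _ => hΛ z)
    have h1 := hD hc.1
    rw [hc', lt_div_iff₀ (by linarith)] at h1
    linarith

lemma mul_sub_le_of_strictMono_deriv {Λ D : ℝ → ℝ} (hΛ : ∀ l, HasDerivAt Λ (D l) l)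
    (hD : StrictMono D) (a l : ℝ) : l * D a - Λ l ≤ a * D a - Λ a := by
  rcases eq_or_ne l a with rfl | h
  · exact le_rfl
  · exact (mul_sub_lt_of_strictMono_deriv hΛ hD h).le

lemma isLUB_dual {Λ D α : ℝ → ℝ} (hΛ : ∀ l, HasDerivAt Λ (D l) l) (hD : StrictMono D)
    (hα : ∀ x, D (α x) = x) (x : ℝ) :
    IsLUB (range fun l : ℝ => l * x - Λ l) (α x * x - Λ (α x)) := by
  refine IsGreatest.isLUB ⟨⟨α x, rfl⟩, ?_⟩
  rintro _ ⟨l, rfl⟩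
  have := mul_sub_le_of_strictMono_deriv hΛ hD (α x) l
  rwa [hα] at this

/-- The maximizer `α w` at the intermediate point competes in the suprema at `x` and at `y`. It
cannot also be the maximizer at `x`, because `D ∘ α` is the identity; this gives the strict
inequality without any regularity of `α`. -/
lemma strictConvexOn_dual {Λ D α : ℝ → ℝ} (hΛ : ∀ l, HasDerivAt Λ (D l) l) (hD : StrictMono D)
    (hα : ∀ x, D (α x) = x) : StrictConvexOn ℝ univ fun x => α x * x - Λ (α x) := by
  refine ⟨convex_univ, fun x _ y _ hxy a b ha hb hab => ?_⟩
  simp only [smul_eq_mul]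
  set w := a * x + b * y with hw
  have hwx : α w ≠ α x := by
    intro h
    have h1 : w = x := by rw [← hα w, h, hα]
    apply hxy
    have : b * (y - x) = 0 := by
      have : a = 1 - b := by linarith
      subst this; linarith
    rcases mul_eq_zero.1 this with h | h <;> linarith
  have h1 := mul_sub_lt_of_strictMono_deriv hΛ hD hwx
  have h2 := mul_sub_le_of_strictMono_deriv hΛ hD (α y) (α w)
  rw [hα] at h1 h2
  have h3 := mul_lt_mul_of_pos_left h1 ha
  have h4 := mul_le_mul_of_nonneg_left h2 hb.le
  have e : Λ (α w) = a * Λ (α w) + b * Λ (α w) := by rw [← add_mul, hab, one_mul]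
  have e2 : α w * w = a * (α w * x) + b * (α w * y) := by rw [hw]; ring
  linarith

lemma isGoodRate_dual {Λ D α : ℝ → ℝ} (hΛ : ∀ l, HasDerivAt Λ (D l) l) (hD : StrictMono D)
    (hα : ∀ x, D (α x) = x) (h0 : Λ 0 = 0) : IsGoodRate fun x => α x * x - Λ (α x) := by
  have key : ∀ x l, l * x - Λ l ≤ α x * x - Λ (α x) := fun x l =>
    (isLUB_dual hΛ hD hα x).1 ⟨l, rfl⟩
  refine ⟨fun x => by simpa [h0] using key x 0, fun c => ?_⟩
  have hset : {x | α x * x - Λ (α x) ≤ c} = ⋂ l : ℝ, {x | l * x - Λ l ≤ c} := by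
    ext x
    simp only [mem_ofPred_eq, mem_iInter]
    exact ⟨fun h l => (key x l).trans h, fun h => h _⟩
  rw [hset]
  refine Metric.isCompact_of_isClosed_isBounded
    (isClosed_iInter fun l => isClosed_le (by fun_prop) (by fun_prop)) ?_
  -- The half-lines for `l = 1` and `l = -1` already bound the level set.
  refine (Metric.isBounded_Icc (-(c + Λ (-1))) (c + Λ 1)).subset fun x hx => ?_
  simp only [mem_iInter, mem_ofPred_eq] at hx
  exact ⟨by linarith [hx (-1)], by linarith [hx 1]⟩

/-! ### The Gärtner–Ellis theorem on the line -/

/-- The tilted law has density `exp(b y - cgf)`, and on the interval `b y` differs from `b x` by at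
most `|b| ε`. -/
lemma tilted_real_Ioo_le (μ : Measure ℝ) [IsProbabilityMeasure μ] {b : ℝ} (x ε : ℝ)
    (hint : Integrable (fun y => Real.exp (b * y)) μ) :
    (μ.tilted fun y => b * y).real (Ioo (x - ε) (x + ε)) *
      Real.exp (cgf id μ b - b * x - |b| * ε) ≤ μ.real (Ioo (x - ε) (x + ε)) := by
  have h := tilted_mul_apply_eq_ofReal_integral_cgf' (X := id) (μ := μ) (t := b)
    (measurableSet_Ioo (a := x - ε) (b := x + ε)) hint
  simp only [id] at h
  rw [Measure.real, h, ENNReal.toReal_ofReal (integral_nonneg fun _ => (Real.exp_pos _).le)]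
  have hle : ∫ a in Ioo (x - ε) (x + ε), Real.exp (b * a - cgf id μ b) ∂μ ≤
      ∫ a in Ioo (x - ε) (x + ε), Real.exp (b * x + |b| * ε - cgf id μ b) ∂μ := by
    refine setIntegral_mono_on ?_ (integrable_const _).integrableOn measurableSet_Ioo fun y hy => ?_
    · simp_rw [Real.exp_sub]
      exact (hint.div_const _).integrableOn
    · apply Real.exp_le_exp.2
      have : b * (y - x) ≤ |b| * ε := by
        refine (le_abs_self _).trans ?_
        rw [abs_mul]
        gcongr
        rw [abs_le]; constructor <;> linarith [hy.1, hy.2]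
      linarith
  refine (mul_le_mul_of_nonneg_right hle (Real.exp_pos _).le).trans_eq ?_
  rw [setIntegral_const, smul_eq_mul, mul_assoc, ← Real.exp_add,
    show b * x + |b| * ε - cgf id μ b + (cgf id μ b - b * x - |b| * ε) = 0 by ring, Real.exp_zero,
    mul_one]

lemma cgf_tilted_eq (μ : Measure ℝ) [IsProbabilityMeasure μ] {b c : ℝ}
    (hint : ∀ l : ℝ, Integrable (fun y => Real.exp (l * y)) μ) :
    cgf id (μ.tilted fun y => b * y) c = cgf id μ (b + c) - cgf id μ b := by
  rw [cgf, cgf, cgf, ← Real.log_div (mgf_pos (X := id) (hint _)).ne'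
    (mgf_pos (X := id) (hint _)).ne']
  congr 1
  have h := integral_tilted_mul_eq_mgf (X := id) (μ := μ) (t := b) (fun y => Real.exp (c * y))
  simp only [id] at h
  rw [mgf, mgf]
  simp only [id]
  rw [h, ← integral_div]
  congr with y
  rw [smul_eq_mul, add_mul, Real.exp_add]
  simp only [mgf, id]
  ring

lemma integrable_exp_mul_tilted (μ : Measure ℝ) [IsProbabilityMeasure μ] (b c : ℝ)
    (hint : ∀ l : ℝ, Integrable (fun y => Real.exp (l * y)) μ) :
    Integrable (fun y => Real.exp (c * y)) (μ.tilted fun y => b * y) := by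
  rw [integrable_tilted_iff (hint b)]
  refine (hint (b + c)).congr (ae_of_all _ fun y => ?_)
  simp [add_mul, Real.exp_add]

/-- The exponents of the Chernoff bounds for the upper and the lower tail. -/
lemma eventually_real_Ici_le {μ : ℕ → Measure ℝ} [∀ n, IsProbabilityMeasure (μ n)] {a : ℕ → ℝ}
    (ha : Tendsto a atTop atTop) (hint : ∀ n l, Integrable (fun y => Real.exp (l * y)) (μ n))
    {l L : ℝ} (hl : 0 ≤ l) (hL : Tendsto (fun n => cgf id (μ n) (a n * l) / a n) atTop (𝓝 L))
    (c : ℝ) {ε : ℝ} (hε : 0 < ε) :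
    ∀ᶠ n in atTop, (μ n).real (Ici c) ≤ Real.exp (-a n * (l * c - L - ε)) := by
  filter_upwards [ha.eventually_gt_atTop 0, hL.eventually_lt_const (lt_add_of_pos_right L hε)]
    with n hn h
  rw [div_lt_iff₀ hn] at h
  refine (measure_ge_le_exp_cgf (X := id) c (mul_nonneg hn.le hl) (hint n _)).trans ?_
  apply Real.exp_le_exp.2
  linarith

lemma eventually_real_Iic_le {μ : ℕ → Measure ℝ} [∀ n, IsProbabilityMeasure (μ n)] {a : ℕ → ℝ}
    (ha : Tendsto a atTop atTop) (hint : ∀ n l, Integrable (fun y => Real.exp (l * y)) (μ n))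
    {l L : ℝ} (hl : l ≤ 0) (hL : Tendsto (fun n => cgf id (μ n) (a n * l) / a n) atTop (𝓝 L))
    (c : ℝ) {ε : ℝ} (hε : 0 < ε) :
    ∀ᶠ n in atTop, (μ n).real (Iic c) ≤ Real.exp (-a n * (l * c - L - ε)) := by
  filter_upwards [ha.eventually_gt_atTop 0, hL.eventually_lt_const (lt_add_of_pos_right L hε)]
    with n hn h
  rw [div_lt_iff₀ hn] at h
  refine (measure_le_le_exp_cgf (X := id) c (mul_nonpos_of_nonneg_of_nonpos hn.le hl)
    (hint n _)).trans ?_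
  apply Real.exp_le_exp.2
  linarith

lemma tendsto_exp_neg_mul_atTop {a : ℕ → ℝ} (ha : Tendsto a atTop atTop) {c : ℝ} (hc : 0 < c) :
    Tendsto (fun n => Real.exp (-a n * c)) atTop (𝓝 0) := by
  refine Real.tendsto_exp_atBot.comp ?_
  simp_rw [neg_mul]
  exact tendsto_neg_atTop_atBot.comp (ha.atTop_mul_const hc)

/-- Under the tilted laws the scaled cumulant generating functions converge to the shifted limit,
and the mass concentrates at the derivative of the limit. -/
lemma tendsto_tilted_Ioo {μ : ℕ → Measure ℝ} [∀ n, IsProbabilityMeasure (μ n)] {a : ℕ → ℝ}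
    (ha : Tendsto a atTop atTop) (hint : ∀ n l, Integrable (fun y => Real.exp (l * y)) (μ n))
    {Λ : ℝ → ℝ} (hL : ∀ l, Tendsto (fun n => cgf id (μ n) (a n * l) / a n) atTop (𝓝 (Λ l)))
    {b x : ℝ} (hb : HasDerivAt Λ x b) {ε : ℝ} (hε : 0 < ε) :
    ∀ᶠ n in atTop, 1 / 2 ≤ ((μ n).tilted fun y => (a n * b) * y).real (Ioo (x - ε) (x + ε)) := by
  set ρ : ℕ → Measure ℝ := fun n => (μ n).tilted fun y => (a n * b) * y with hρ
  have hprob : ∀ n, IsProbabilityMeasure (ρ n) := fun n => isProbabilityMeasure_tilted (hint n _)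
  have hρint : ∀ n l, Integrable (fun y => Real.exp (l * y)) (ρ n) := fun n l =>
    integrable_exp_mul_tilted (μ n) _ _ (hint n)
  have hρL : ∀ d, Tendsto (fun n => cgf id (ρ n) (a n * d) / a n) atTop
      (𝓝 (Λ (b + d) - Λ b)) := by
    intro d
    refine ((hL (b + d)).sub (hL b)).congr fun n => ?_
    rw [cgf_tilted_eq (μ n) (hint n), ← mul_add, sub_div]
  have hslope := (hasDerivAt_iff_tendsto_slope_zero.1 hb)
  simp only [smul_eq_mul] at hslope
  have hev := hslope.eventually (Ioo_mem_nhds (show x - ε / 2 < x by linarith)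
    (show x < x + ε / 2 by linarith))
  rw [eventually_nhdsWithin_iff, Metric.eventually_nhds_iff] at hev
  obtain ⟨δ, hδ, hev⟩ := hev
  -- Difference quotients at `±δ/2` lie within `ε/2` of the derivative; these two increments serve
  -- as Chernoff parameters for the two tails.
  have hp := hev (y := δ / 2) (by simp [abs_of_pos hδ, hδ]) (by simp [hδ.ne'])
  have hm := hev (y := -(δ / 2)) (by simp [abs_of_pos hδ, hδ]) (by simp [hδ.ne'])
  have hp2 : Λ (b + δ / 2) - Λ b < (δ / 2) * (x + ε / 2) := by
    have := hp.2
    rwa [inv_mul_lt_iff₀ (by linarith)] at this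
  have hm2 : Λ (b + -(δ / 2)) - Λ b < -(δ / 2) * (x - ε / 2) := by
    have := hm.1
    rw [inv_neg, neg_mul, lt_neg, inv_mul_lt_iff₀ (by linarith)] at this
    linarith
  -- The Chernoff exponents exceed `(δ/2)(ε/2) = 2s`. One `s` pays for replacing the scaled
  -- generating function by its limit, the other leaves exponential decay.
  set s := δ * ε / 8 with hs
  have hspos : 0 < s := by positivity
  have h1 := eventually_real_Ici_le ha hρint (by linarith : 0 ≤ δ / 2) (hρL (δ / 2)) (x + ε) hspos
  have h2 := eventually_real_Iic_le ha hρint (by linarith : -(δ / 2) ≤ 0) (hρL (-(δ / 2)))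
    (x - ε) hspos
  have h3 := (tendsto_exp_neg_mul_atTop ha hspos).eventually_lt_const
    (show (0 : ℝ) < 1 / 4 by norm_num)
  filter_upwards [h1, h2, h3, ha.eventually_gt_atTop 0] with n h1 h2 h3 hn
  have e1 : Real.exp (-a n * (δ / 2 * (x + ε) - (Λ (b + δ / 2) - Λ b) - s)) ≤
      Real.exp (-a n * s) := by
    apply Real.exp_le_exp.2
    rw [neg_mul (a n), neg_mul (a n), neg_le_neg_iff]
    gcongr
    nlinarith
  have e2 : Real.exp (-a n * (-(δ / 2) * (x - ε) - (Λ (b + -(δ / 2)) - Λ b) - s)) ≤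
      Real.exp (-a n * s) := by
    apply Real.exp_le_exp.2
    rw [neg_mul (a n), neg_mul (a n), neg_le_neg_iff]
    gcongr
    nlinarith
  have hun : (1 : ℝ) ≤ (ρ n).real (Ioo (x - ε) (x + ε)) + ((ρ n).real (Iic (x - ε)) +
      (ρ n).real (Ici (x + ε))) := by
    have hu : (univ : Set ℝ) ⊆ Ioo (x - ε) (x + ε) ∪ (Iic (x - ε) ∪ Ici (x + ε)) := by
      intro y _
      simp only [mem_union, mem_Ioo, mem_Iic, mem_Ici]
      by_cases h : y ≤ x - ε
      · tauto
      · by_cases h' : x + ε ≤ y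
        · tauto
        · left; push Not at h h'; exact ⟨h, h'⟩
    calc (1 : ℝ) = (ρ n).real univ := by simp
      _ ≤ _ := measureReal_mono hu
      _ ≤ _ := measureReal_union_le _ _
      _ ≤ _ := by gcongr; exact measureReal_union_le _ _
  linarith

/-- The change of measure costs `exp(-a n (b x - Λ b))` up to errors, and the tilted law gives the
interval mass at least `1/2`. Three errors of `δ/4` each arise: the width of a shrunken interval,
the convergence of the generating function at `b`, and the factor `1/2`. -/
lemma eventually_exp_le_real_Ioo {μ : ℕ → Measure ℝ} [∀ n, IsProbabilityMeasure (μ n)] {a : ℕ → ℝ}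
    (ha : Tendsto a atTop atTop) (hint : ∀ n l, Integrable (fun y => Real.exp (l * y)) (μ n))
    {Λ : ℝ → ℝ} (hL : ∀ l, Tendsto (fun n => cgf id (μ n) (a n * l) / a n) atTop (𝓝 (Λ l)))
    {b x : ℝ} (hb : HasDerivAt Λ x b) {ε δ : ℝ} (hε : 0 < ε) (hδ : 0 < δ) :
    ∀ᶠ n in atTop, Real.exp (-a n * (b * x - Λ b + δ)) ≤ (μ n).real (Ioo (x - ε) (x + ε)) := by
  obtain ⟨ε', hε', hle, hsm⟩ : ∃ ε' > 0, ε' ≤ ε ∧ |b| * ε' ≤ δ / 4 := by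
    refine ⟨min ε (δ / (4 * (|b| + 1))), by positivity, min_le_left _ _, ?_⟩
    calc |b| * min ε (δ / (4 * (|b| + 1))) ≤ (|b| + 1) * (δ / (4 * (|b| + 1))) := by
          gcongr
          · linarith
          · exact min_le_right _ _
      _ = δ / 4 := by field_simp
  have h3 := (tendsto_exp_neg_mul_atTop ha (by linarith : 0 < δ / 4)).eventually_lt_const
    (show (0 : ℝ) < 1 / 2 by norm_num)
  filter_upwards [tendsto_tilted_Ioo ha hint hL hb hε', ha.eventually_gt_atTop 0, h3,
    (hL b).eventually_const_lt (show Λ b - δ / 4 < Λ b by linarith)] with n h1 hn h3 h4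
  have h2 := tilted_real_Ioo_le (μ n) (b := a n * b) x ε' (hint n _)
  rw [lt_div_iff₀ hn] at h4
  calc Real.exp (-a n * (b * x - Λ b + δ))
      ≤ Real.exp (-a n * (δ / 4)) *
        Real.exp (cgf id (μ n) (a n * b) - a n * b * x - |a n * b| * ε') := by
        rw [← Real.exp_add]
        apply Real.exp_le_exp.2
        rw [abs_mul, abs_of_pos hn]
        have := mul_le_mul_of_nonneg_left hsm hn.le
        nlinarith
    _ ≤ ((μ n).tilted fun y => (a n * b) * y).real (Ioo (x - ε') (x + ε')) *
        Real.exp (cgf id (μ n) (a n * b) - a n * b * x - |a n * b| * ε') := by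
        gcongr
        linarith
    _ ≤ _ := h2
    _ ≤ _ := measureReal_mono (Ioo_subset_Ioo (by linarith) (by linarith))

lemma inv_mul_log_le_of_le_exp {a z : ℝ} (ha : 0 < a) {q : ℝ≥0∞}
    (h : q ≤ ENNReal.ofReal (Real.exp (a * z))) :
    ((1 / a : ℝ) : EReal) * ENNReal.log q ≤ (z : EReal) := by
  have h1 : ENNReal.log q ≤ ((a * z : ℝ) : EReal) := by
    refine (ENNReal.log_le_log h).trans_eq ?_
    rw [ENNReal.log_ofReal_of_pos (Real.exp_pos _), Real.log_exp]
  refine (mul_le_mul_of_nonneg_left h1 (EReal.coe_nonneg.2 (by positivity))).trans_eq ?_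
  rw [← EReal.coe_mul]
  congr 1
  field_simp

lemma le_inv_mul_log_of_exp_le {a z : ℝ} (ha : 0 < a) {q : ℝ≥0∞}
    (h : ENNReal.ofReal (Real.exp (a * z)) ≤ q) :
    (z : EReal) ≤ ((1 / a : ℝ) : EReal) * ENNReal.log q := by
  have h1 : ((a * z : ℝ) : EReal) ≤ ENNReal.log q := by
    refine Eq.trans_le ?_ (ENNReal.log_le_log h)
    rw [ENNReal.log_ofReal_of_pos (Real.exp_pos _), Real.log_exp]
  refine Eq.trans_le ?_ (mul_le_mul_of_nonneg_left h1 (EReal.coe_nonneg.2 (by positivity)))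
  rw [← EReal.coe_mul]
  congr 1
  field_simp

/-- The upper bound for closed sets, in exponential form. -/
lemma eventually_real_le_of_isClosed {μ : ℕ → Measure ℝ} [∀ n, IsProbabilityMeasure (μ n)]
    {a : ℕ → ℝ} (ha : Tendsto a atTop atTop)
    (hint : ∀ n l, Integrable (fun y => Real.exp (l * y)) (μ n)) {Λ D α : ℝ → ℝ}
    (hL : ∀ l, Tendsto (fun n => cgf id (μ n) (a n * l) / a n) atTop (𝓝 (Λ l)))
    (hD : StrictMono D) (hα : ∀ x, D (α x) = x)
    {F : Set ℝ} (hF : IsClosed F) {J : ℝ} (hJ : ∀ x ∈ F, J ≤ α x * x - Λ (α x)) {ε : ℝ}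
    (hε : 0 < ε) : ∀ᶠ n in atTop, (μ n).real F ≤ Real.exp (-a n * (J - ε)) := by
  -- `F` is split at the limiting mean `D 0`. The right part lies in the half-line starting at its
  -- least point `c`, where `α c ≥ 0`, so one Chernoff bound with tilt `α c` suffices and its
  -- exponent is the rate at `c`. The left part is symmetric. No exponential tightness is needed.
  have hup : ∀ᶠ n in atTop, (μ n).real (F ∩ Ici (D 0)) ≤ Real.exp (-a n * (J - ε / 2)) := by
    rcases (F ∩ Ici (D 0)).eq_empty_or_nonempty with h | h
    · exact Eventually.of_forall fun n => by simp [h, (Real.exp_pos _).le]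
    · have hbdd : BddBelow (F ∩ Ici (D 0)) := ⟨D 0, fun y hy => hy.2⟩
      set c := sInf (F ∩ Ici (D 0))
      have hc : c ∈ F ∩ Ici (D 0) := (hF.inter isClosed_Ici).csInf_mem h hbdd
      have hαc : 0 ≤ α c := hD.le_iff_le.1 (by rw [hα]; exact hc.2)
      filter_upwards [eventually_real_Ici_le ha hint hαc (hL _) c (half_pos hε),
        ha.eventually_gt_atTop 0] with n hn han
      refine (measureReal_mono fun y hy => csInf_le hbdd hy).trans (hn.trans ?_)
      apply Real.exp_le_exp.2
      rw [neg_mul, neg_mul, neg_le_neg_iff]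
      gcongr
      exact hJ c hc.1
  have hdown : ∀ᶠ n in atTop, (μ n).real (F ∩ Iic (D 0)) ≤ Real.exp (-a n * (J - ε / 2)) := by
    rcases (F ∩ Iic (D 0)).eq_empty_or_nonempty with h | h
    · exact Eventually.of_forall fun n => by simp [h, (Real.exp_pos _).le]
    · have hbdd : BddAbove (F ∩ Iic (D 0)) := ⟨D 0, fun y hy => hy.2⟩
      set c := sSup (F ∩ Iic (D 0))
      have hc : c ∈ F ∩ Iic (D 0) := (hF.inter isClosed_Iic).csSup_mem h hbdd
      have hαc : α c ≤ 0 := hD.le_iff_le.1 (by rw [hα]; exact hc.2)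
      filter_upwards [eventually_real_Iic_le ha hint hαc (hL _) c (half_pos hε),
        ha.eventually_gt_atTop 0] with n hn han
      refine (measureReal_mono fun y hy => le_csSup hbdd hy).trans (hn.trans ?_)
      apply Real.exp_le_exp.2
      rw [neg_mul, neg_mul, neg_le_neg_iff]
      gcongr
      exact hJ c hc.1
  -- The factor `2` from the two pieces is absorbed by the spare `ε/2` in the exponent.
  have h3 := (tendsto_exp_neg_mul_atTop ha (half_pos hε)).eventually_lt_const
    (show (0 : ℝ) < 1 / 2 by norm_num)
  filter_upwards [hup, hdown, h3] with n h1 h2 h3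
  calc (μ n).real F ≤ (μ n).real ((F ∩ Ici (D 0)) ∪ (F ∩ Iic (D 0))) := by
        refine measureReal_mono fun y hy => ?_
        rcases le_total (D 0) y with h | h
        · exact Or.inl ⟨hy, h⟩
        · exact Or.inr ⟨hy, h⟩
    _ ≤ _ := measureReal_union_le _ _
    _ ≤ 2 * Real.exp (-a n * (J - ε / 2)) := by linarith
    _ = 2 * Real.exp (-a n * (ε / 2)) * Real.exp (-a n * (J - ε)) := by
        rw [mul_assoc, ← Real.exp_add]; congr 2; ring
    _ ≤ 1 * Real.exp (-a n * (J - ε)) := by gcongr; linarith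
    _ = _ := one_mul _

/-- Since `D (α x) = x` for every `x`, each point is the derivative of `Λ` somewhere, and the lower
bound applies around every point of an open set. -/
theorem satisfiesLDP_of_tendsto_cgf {Ω : ℕ → Type*} [∀ n, MeasurableSpace (Ω n)]
    {P : ∀ n, Measure (Ω n)} [∀ n, IsProbabilityMeasure (P n)] {Y : ∀ n, Ω n → ℝ}
    (hY : ∀ n, AEMeasurable (Y n) (P n)) {a : ℕ → ℝ} (ha : Tendsto a atTop atTop)
    (hint : ∀ n l, Integrable (fun ω => Real.exp (l * Y n ω)) (P n)) {Λ D α : ℝ → ℝ}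
    (hL : ∀ l, Tendsto (fun n => cgf (Y n) (P n) (a n * l) / a n) atTop (𝓝 (Λ l)))
    (hΛ : ∀ l, HasDerivAt Λ (D l) l) (hD : StrictMono D) (hα : ∀ x, D (α x) = x) :
    SatisfiesLDP P Y a fun x => α x * x - Λ (α x) := by
  set μ : ℕ → Measure ℝ := fun n => (P n).map (Y n) with hμ
  have hprob : ∀ n, IsProbabilityMeasure (μ n) := fun n => Measure.isProbabilityMeasure_map (hY n)
  have hμint : ∀ n l, Integrable (fun y => Real.exp (l * y)) (μ n) := fun n l =>
    (integrable_map_measure (by fun_prop) (hY n)).2 (hint n l)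
  have hμL : ∀ l, Tendsto (fun n => cgf id (μ n) (a n * l) / a n) atTop (𝓝 (Λ l)) := by
    intro l
    refine (hL l).congr fun n => ?_
    rw [cgf, cgf, mgf_id_map (hY n)]
  have hpre : ∀ n {S : Set ℝ}, MeasurableSet S → P n {ω | Y n ω ∈ S} = μ n S := fun n S hS =>
    (Measure.map_apply_of_aemeasurable (hY n) hS).symm
  constructor
  · intro F hF
    -- Comparison with real `z` only, which also covers an infinite infimum, as for empty `F`.
    refine EReal.le_of_forall_lt_iff_le.1 fun z hz => ?_
    have hz' : ((-z : ℝ) : EReal) < ⨅ x ∈ F, ((α x * x - Λ (α x) : ℝ) : EReal) := by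
      rw [EReal.coe_neg]
      exact EReal.neg_lt_comm.1 hz
    obtain ⟨J, hzJ, hJ⟩ := EReal.lt_iff_exists_real_btwn.1 hz'
    have hJ' : ∀ x ∈ F, J ≤ α x * x - Λ (α x) := fun x hx =>
      EReal.coe_le_coe_iff.1 (hJ.le.trans (iInf₂_le x hx))
    have hzJ' : -z < J := EReal.coe_lt_coe_iff.1 hzJ
    refine limsup_le_of_le (by isBoundedDefault) ?_
    filter_upwards [eventually_real_le_of_isClosed ha hμint hμL hD hα hF hJ'
      (show 0 < J + z by linarith), ha.eventually_gt_atTop 0] with n hn han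
    refine inv_mul_log_le_of_le_exp han ?_
    rw [hpre n hF.measurableSet, ← ofReal_measureReal]
    refine ENNReal.ofReal_le_ofReal (hn.trans_eq ?_)
    congr 1; ring
  · intro G hG
    rw [EReal.neg_le]
    refine le_iInf₂ fun x hx => ?_
    rw [EReal.neg_le]
    refine EReal.ge_of_forall_gt_iff_ge.1 fun z hz => ?_
    rw [← EReal.coe_neg, EReal.coe_lt_coe_iff] at hz
    obtain ⟨ε, hε, hball⟩ := Metric.isOpen_iff.1 hG x hx
    rw [Real.ball_eq_Ioo] at hball
    refine le_liminf_of_le (by isBoundedDefault) ?_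
    have hder : HasDerivAt Λ x (α x) := by
      have := hΛ (α x)
      rwa [hα] at this
    filter_upwards [eventually_exp_le_real_Ioo ha hμint hμL hder hε
      (show 0 < -z - (α x * x - Λ (α x)) by linarith), ha.eventually_gt_atTop 0] with n hn han
    refine le_inv_mul_log_of_exp_le han ?_
    rw [hpre n hG.measurableSet, ← ofReal_measureReal]
    refine ENNReal.ofReal_le_ofReal (le_trans (le_of_eq ?_) (hn.trans (measureReal_mono hball)))
    congr 1; ring

/-! ### Tilted Bernoulli variables -/

/-- The logarithmic moment generating function at `l` of a Bernoulli variable of mean `q`. -/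
def bernCGF (l q : ℝ) : ℝ := Real.log (1 + (Real.exp l - 1) * q)

/-- The mean of the Bernoulli variable of mean `q` tilted by `l`. -/
def bernTilt (l q : ℝ) : ℝ := Real.exp l * q / (1 + (Real.exp l - 1) * q)

lemma exp_neg_abs_le_one_add {l q : ℝ} (h0 : 0 ≤ q) (h1 : q ≤ 1) :
    Real.exp (-|l|) ≤ 1 + (Real.exp l - 1) * q := by
  have h2 : Real.exp (-|l|) ≤ 1 := Real.exp_le_one_iff.2 (by simp)
  have h3 : Real.exp (-|l|) ≤ Real.exp l := Real.exp_le_exp.2 (neg_abs_le l)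
  nlinarith

lemma one_add_le_exp_abs {l q : ℝ} (h0 : 0 ≤ q) (h1 : q ≤ 1) :
    1 + (Real.exp l - 1) * q ≤ Real.exp |l| := by
  have h2 : 1 ≤ Real.exp |l| := Real.one_le_exp (by simp)
  have h3 : Real.exp l ≤ Real.exp |l| := Real.exp_le_exp.2 (le_abs_self l)
  nlinarith

lemma one_add_exp_sub_pos {l q : ℝ} (h0 : 0 ≤ q) (h1 : q ≤ 1) :
    0 < 1 + (Real.exp l - 1) * q :=
  (Real.exp_pos _).trans_le (exp_neg_abs_le_one_add h0 h1)

lemma abs_bernCGF_le {l q : ℝ} (h0 : 0 ≤ q) (h1 : q ≤ 1) : |bernCGF l q| ≤ |l| := by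
  have hp := one_add_exp_sub_pos (l := l) h0 h1
  rw [abs_le, bernCGF, Real.le_log_iff_exp_le hp, Real.log_le_iff_le_exp hp]
  exact ⟨exp_neg_abs_le_one_add h0 h1, one_add_le_exp_abs h0 h1⟩

/-- From `1 - 1/u ≤ log u ≤ u - 1`. Linearity in `q` lets summability or integrability of crossing
probabilities pass to the generating functions. -/
lemma abs_bernCGF_le_mul {l q : ℝ} (h0 : 0 ≤ q) (h1 : q ≤ 1) :
    |bernCGF l q| ≤ Real.exp |l| * q := by
  have hp := one_add_exp_sub_pos (l := l) h0 h1
  have hup := Real.log_le_sub_one_of_pos hp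
  have hlo := Real.one_sub_inv_le_log_of_pos hp
  have h2 : 1 ≤ Real.exp |l| := Real.one_le_exp (by simp)
  rw [bernCGF, abs_le]
  rcases le_total 0 l with hl | hl
  · rw [abs_of_nonneg hl] at *
    have : 0 ≤ 1 - (1 + (Real.exp l - 1) * q)⁻¹ := by
      rw [sub_nonneg]
      exact inv_le_one_of_one_le₀ (by nlinarith)
    constructor <;> nlinarith
  · rw [abs_of_nonpos hl] at *
    have hl1 : Real.exp l ≤ 1 := Real.exp_le_one_iff.2 hl
    have hm : Real.exp (-l) * Real.exp l = 1 := by rw [← Real.exp_add]; simp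
    have hinv : (1 + (Real.exp l - 1) * q)⁻¹ ≤ 1 + Real.exp (-l) * q := by
      rw [inv_le_iff_one_le_mul₀ hp]
      have : 1 ≤ Real.exp (-l) * (1 + (Real.exp l - 1) * q) := by nlinarith
      nlinarith [mul_le_mul_of_nonneg_left this h0, mul_nonneg (Real.exp_pos l).le h0]
    constructor <;> nlinarith

lemma bernTilt_nonneg {l q : ℝ} (h0 : 0 ≤ q) (h1 : q ≤ 1) : 0 ≤ bernTilt l q :=
  div_nonneg (mul_nonneg (Real.exp_pos _).le h0) (one_add_exp_sub_pos h0 h1).le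

lemma bernTilt_le {l q : ℝ} (h0 : 0 ≤ q) (h1 : q ≤ 1) : bernTilt l q ≤ Real.exp |l| * q := by
  rw [bernTilt, div_le_iff₀ (one_add_exp_sub_pos h0 h1)]
  have h2 : 1 ≤ Real.exp |l| := Real.one_le_exp (by simp)
  have h3 : Real.exp l ≤ Real.exp |l| * (1 + (Real.exp l - 1) * q) := by
    rcases le_total 0 l with hl | hl
    · have : 1 ≤ Real.exp l := Real.one_le_exp hl
      rw [abs_of_nonneg hl]
      nlinarith [mul_nonneg (sub_nonneg.2 this) h0, Real.exp_pos l]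
    · have hl1 : Real.exp l ≤ 1 := Real.exp_le_one_iff.2 hl
      have := one_add_exp_sub_pos (l := l) h0 h1
      nlinarith
  nlinarith

lemma hasDerivAt_bernCGF {q : ℝ} (h0 : 0 ≤ q) (h1 : q ≤ 1) (l : ℝ) :
    HasDerivAt (fun l => bernCGF l q) (bernTilt l q) l := by
  have := (((Real.hasDerivAt_exp l).sub_const 1).mul_const q).const_add 1
  exact this.log (one_add_exp_sub_pos h0 h1).ne'

lemma bernTilt_strictMono {q : ℝ} (h0 : 0 < q) (h1 : q < 1) :
    StrictMono fun l => bernTilt l q := by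
  intro l m hlm
  have hE := Real.exp_lt_exp.2 hlm
  simp only [bernTilt]
  rw [div_lt_div_iff₀ (one_add_exp_sub_pos h0.le h1.le) (one_add_exp_sub_pos h0.le h1.le)]
  nlinarith [mul_pos (mul_pos h0 (sub_pos.2 h1)) (sub_pos.2 hE)]

lemma bernTilt_mono_right {l q q' : ℝ} (h0 : 0 ≤ q) (hq : q ≤ q') (h1 : q' ≤ 1) :
    bernTilt l q ≤ bernTilt l q' := by
  rw [bernTilt, bernTilt, div_le_div_iff₀ (one_add_exp_sub_pos h0 (hq.trans h1))
    (one_add_exp_sub_pos (h0.trans hq) h1)]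
  nlinarith [mul_nonneg (Real.exp_pos l).le (sub_nonneg.2 hq)]

lemma bernCGF_monotone {q : ℝ} (h0 : 0 ≤ q) (h1 : q ≤ 1) : Monotone fun l => bernCGF l q := by
  intro l m hlm
  apply Real.log_le_log (one_add_exp_sub_pos h0 h1)
  have := Real.exp_le_exp.2 hlm
  gcongr

lemma bernCGF_nonneg {l q : ℝ} (h0 : 0 ≤ q) (hl : 0 ≤ l) : 0 ≤ bernCGF l q := by
  apply Real.log_nonneg
  have := Real.one_le_exp hl
  nlinarith

lemma tendsto_bernTilt {q : ℝ} (h0 : 0 < q) :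
    Tendsto (fun l => bernTilt l q) atTop (𝓝 1) := by
  have h : Tendsto (fun l : ℝ => q / (Real.exp (-l) * (1 - q) + q)) atTop
      (𝓝 (q / (0 * (1 - q) + q))) := by
    refine tendsto_const_nhds.div ?_ (by simp [h0.ne'])
    exact ((Real.tendsto_exp_neg_atTop_nhds_zero).mul_const _).add_const _
  rw [zero_mul, zero_add, div_self h0.ne'] at h
  refine h.congr fun l => ?_
  rw [bernTilt, Real.exp_neg]
  field_simp
  congr 1
  ring

/-! ### Functions sharing the properties of the occupation generating function -/

/-- The properties of `γ` used in the analysis of the rate function. -/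
structure IsOccupationCGF (g : ℝ → ℝ) : Prop where
  zero : g 0 = 0
  differentiable : Differentiable ℝ g
  continuous_deriv : Continuous (deriv g)
  monotone_deriv : Monotone (deriv g)
  deriv_pos : ∀ z, 0 < deriv g z

lemma IsOccupationCGF.hasDerivAt {g : ℝ → ℝ} (hg : IsOccupationCGF g) (z : ℝ) :
    HasDerivAt g (deriv g z) z := (hg.differentiable z).hasDerivAt

lemma IsOccupationCGF.tangent_le {g : ℝ → ℝ} (hg : IsOccupationCGF g) (z θ : ℝ) :
    θ * deriv g z - g θ ≤ z * deriv g z - g z := by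
  rcases lt_trichotomy θ z with h | rfl | h
  · obtain ⟨c, hc, hc'⟩ := exists_hasDerivAt_eq_slope g (deriv g) h
      hg.differentiable.continuous.continuousOn (fun z _ => hg.hasDerivAt z)
    have h1 := hg.monotone_deriv hc.2.le
    rw [hc', div_le_iff₀ (by linarith)] at h1
    linarith
  · exact le_rfl
  · obtain ⟨c, hc, hc'⟩ := exists_hasDerivAt_eq_slope g (deriv g) h
      hg.differentiable.continuous.continuousOn (fun z _ => hg.hasDerivAt z)
    have h1 := hg.monotone_deriv hc.1.le
    rw [hc', le_div_iff₀ (by linarith)] at h1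
    linarith

lemma IsOccupationCGF.bddAbove {g : ℝ → ℝ} (hg : IsOccupationCGF g) (z : ℝ) :
    BddAbove (range fun θ : ℝ => θ * deriv g z - g θ) :=
  ⟨z * deriv g z - g z, by rintro _ ⟨θ, rfl⟩; exact hg.tangent_le z θ⟩

lemma IsOccupationCGF.convexDual_deriv {g : ℝ → ℝ} (hg : IsOccupationCGF g) (z : ℝ) :
    convexDual g (deriv g z) = z * deriv g z - g z :=
  le_antisymm (ciSup_le fun θ => hg.tangent_le z θ) (le_ciSup (hg.bddAbove z) z)

/-- The derivative is positive and increasing, hence bounded by `deriv g b` on `(-∞, b]`; the mean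
value inequality from `g 0 = 0` then applies. -/
lemma IsOccupationCGF.abs_le {g : ℝ → ℝ} (hg : IsOccupationCGF g) {b z : ℝ} (hz : |z| ≤ b) :
    |g z| ≤ deriv g b * |z| := by
  have h := Convex.norm_image_sub_le_of_norm_deriv_le (𝕜 := ℝ) (f := g) (s := Iic b) (x := 0)
    (y := z) (C := deriv g b) (fun x _ => hg.differentiable x)
    (fun x hx => by
      rw [Real.norm_eq_abs, abs_of_pos (hg.deriv_pos x)]
      exact hg.monotone_deriv hx)
    (convex_Iic b) ((abs_nonneg z).trans hz) ((le_abs_self z).trans hz)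
  simpa [hg.zero] using h

lemma IsOccupationCGF.abs_comp_bernCGF_le {g : ℝ → ℝ} (hg : IsOccupationCGF g) {b l q : ℝ}
    (hl : |l| ≤ b) (h0 : 0 ≤ q) (h1 : q ≤ 1) :
    |g (bernCGF l q)| ≤ deriv g b * Real.exp b * q := by
  refine (hg.abs_le ((abs_bernCGF_le h0 h1).trans hl)).trans ?_
  rw [mul_assoc]
  have := (hg.deriv_pos b).le
  gcongr
  refine (abs_bernCGF_le_mul h0 h1).trans ?_
  gcongr

/-- The derivative in `l` of `g (bernCGF l q)`. -/
def siteTilt (g : ℝ → ℝ) (l q : ℝ) : ℝ := deriv g (bernCGF l q) * bernTilt l q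

lemma IsOccupationCGF.hasDerivAt_comp_bernCGF {g : ℝ → ℝ} (hg : IsOccupationCGF g) {q : ℝ}
    (h0 : 0 ≤ q) (h1 : q ≤ 1) (l : ℝ) :
    HasDerivAt (fun l => g (bernCGF l q)) (siteTilt g l q) l :=
  (hg.hasDerivAt _).comp l (hasDerivAt_bernCGF h0 h1 l)

lemma IsOccupationCGF.siteTilt_nonneg {g : ℝ → ℝ} (hg : IsOccupationCGF g) {l q : ℝ}
    (h0 : 0 ≤ q) (h1 : q ≤ 1) : 0 ≤ siteTilt g l q :=
  mul_nonneg (hg.deriv_pos _).le (bernTilt_nonneg h0 h1)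

lemma IsOccupationCGF.siteTilt_le {g : ℝ → ℝ} (hg : IsOccupationCGF g) {b l q : ℝ}
    (hl : |l| ≤ b) (h0 : 0 ≤ q) (h1 : q ≤ 1) :
    siteTilt g l q ≤ deriv g b * Real.exp b * q := by
  rw [siteTilt, mul_assoc]
  have h2 := hg.monotone_deriv
    ((le_abs_self _).trans ((abs_bernCGF_le (l := l) h0 h1).trans hl))
  have h3 : bernTilt l q ≤ Real.exp b * q := (bernTilt_le h0 h1).trans (by gcongr)
  exact mul_le_mul h2 h3 (bernTilt_nonneg h0 h1) (hg.deriv_pos b).le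

/-- Strictness comes from the Bernoulli factor together with positivity of `g'`. The factor `g'`
itself may be constant, as when `ν` is a point mass. -/
lemma IsOccupationCGF.siteTilt_strictMono {g : ℝ → ℝ} (hg : IsOccupationCGF g) {q : ℝ}
    (h0 : 0 < q) (h1 : q < 1) : StrictMono fun l => siteTilt g l q := by
  intro l m hlm
  have h2 := hg.monotone_deriv (bernCGF_monotone h0.le h1.le hlm.le)
  have h3 := bernTilt_strictMono h0 h1 hlm
  simp only [siteTilt] at *
  calc deriv g (bernCGF l q) * bernTilt l q < deriv g (bernCGF l q) * bernTilt m q :=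
        mul_lt_mul_of_pos_left h3 (hg.deriv_pos _)
    _ ≤ _ := mul_le_mul_of_nonneg_right h2 (bernTilt_nonneg h0.le h1.le)

lemma measurable_bernCGF : Measurable fun x : ℝ × ℝ => bernCGF x.1 x.2 := by
  unfold bernCGF; fun_prop

lemma measurable_bernTilt : Measurable fun x : ℝ × ℝ => bernTilt x.1 x.2 := by
  unfold bernTilt; fun_prop

lemma continuousOn_bernCGF (l : ℝ) : ContinuousOn (bernCGF l) (Icc 0 1) := by
  intro q hq
  refine ContinuousAt.continuousWithinAt ?_
  exact ContinuousAt.log (by fun_prop) (one_add_exp_sub_pos hq.1 hq.2).ne'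

/-! ### Gaussian tails -/

/-- Chebyshev's inequality, for any subset of the deviation event, so that it applies directly to
one-sided tails of the Gaussian law and of the walks. -/
lemma real_mul_sq_le_variance {Ω : Type*} [MeasurableSpace Ω] {P : Measure Ω}
    [IsProbabilityMeasure P] {X : Ω → ℝ} (hX : MemLp X 2 P) {c : ℝ} (hc : 0 ≤ c) {A : Set Ω}
    (hA : A ⊆ {ω | c ≤ |X ω - ∫ ω, X ω ∂P|}) : P.real A * c ^ 2 ≤ variance X P := by
  have h := mul_meas_ge_le_integral_of_nonneg (μ := P) (f := fun ω => (X ω - ∫ ω, X ω ∂P) ^ 2)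
    (ae_of_all _ fun ω => sq_nonneg _) ((hX.sub (memLp_const _)).integrable_sq) (c ^ 2)
  rw [variance_eq_integral hX.aemeasurable, mul_comm]
  refine le_trans ?_ h
  gcongr
  · exact measure_ne_top _ _
  refine hA.trans fun ω hω => ?_
  simp only [mem_ofPred_eq] at hω ⊢
  rw [← sq_abs (X ω - _)]
  gcongr

lemma gaussCDF_eq {s : ℝ≥0} (hs : s ≠ 0) (y : ℝ) :
    gaussCDF s y = (gaussianReal 0 s).real (Iic y) := by
  rw [gaussCDF, Measure.real, gaussianReal_apply_eq_integral 0 hs, ENNReal.toReal_ofReal]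
  exact integral_nonneg fun _ => gaussianPDFReal_nonneg _ _ _

lemma gaussianReal_real_pos {s : ℝ≥0} (hs : s ≠ 0) {A : Set ℝ} (hA : volume A ≠ 0) :
    0 < (gaussianReal 0 s).real A := by
  rw [measureReal_def, ENNReal.toReal_pos_iff]
  refine ⟨pos_iff_ne_zero.2 fun h => hA (gaussianReal_absolutelyContinuous' 0 hs h),
    measure_lt_top _ _⟩

lemma one_sub_gaussCDF {s : ℝ≥0} (hs : s ≠ 0) (y : ℝ) :
    1 - gaussCDF s y = (gaussianReal 0 s).real (Ioi y) := by
  rw [gaussCDF_eq hs, ← compl_Iic, probReal_compl_eq_one_sub measurableSet_Iic]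

lemma gaussCDF_pos {s : ℝ≥0} (hs : s ≠ 0) (y : ℝ) : 0 < gaussCDF s y := by
  rw [gaussCDF_eq hs]
  exact gaussianReal_real_pos hs (by simp)

lemma gaussCDF_lt_one {s : ℝ≥0} (hs : s ≠ 0) (y : ℝ) : gaussCDF s y < 1 := by
  have : 0 < 1 - gaussCDF s y := by
    rw [one_sub_gaussCDF hs]
    exact gaussianReal_real_pos hs (by simp)
  linarith

lemma gaussCDF_monotone {s : ℝ≥0} (hs : s ≠ 0) : Monotone (gaussCDF s) := by
  intro x y hxy
  rw [gaussCDF_eq hs, gaussCDF_eq hs]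
  exact measureReal_mono (Iic_subset_Iic.2 hxy)

lemma gaussCDF_neg {s : ℝ≥0} (hs : s ≠ 0) (y : ℝ) : gaussCDF s (-y) = 1 - gaussCDF s y := by
  have h : (gaussianReal 0 s).real (Iic (-y)) = (gaussianReal 0 s).real (Ici y) := by
    conv_lhs => rw [← neg_zero, ← gaussianReal_map_neg]
    rw [map_measureReal_apply measurable_neg measurableSet_Iic]
    congr 1
    ext z
    simp
  have := nullSingletonClass_gaussianReal (μ := 0) hs
  rw [gaussCDF_eq hs, h, one_sub_gaussCDF hs]
  exact measureReal_congr Ioi_ae_eq_Ici.symm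

/-- The probability that a Gaussian particle crosses the origin, from distance `|y|`. -/
def gaussTail (s : ℝ≥0) (y : ℝ) : ℝ := if 0 < y then 1 - gaussCDF s y else gaussCDF s y

/-- The sign of the contribution to the current of a particle started at `y`. -/
def crossSign (y : ℝ) : ℝ := if 0 < y then 1 else -1

lemma abs_crossSign (y : ℝ) : |crossSign y| = 1 := by
  unfold crossSign; split_ifs <;> simp

lemma abs_crossSign_mul (y l : ℝ) : |crossSign y * l| = |l| := by
  rw [abs_mul, abs_crossSign, one_mul]

lemma measurable_crossSign : Measurable crossSign :=
  Measurable.ite measurableSet_Ioi measurable_const measurable_const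

lemma measurable_gaussTail {s : ℝ≥0} (hs : s ≠ 0) : Measurable (gaussTail s) :=
  Measurable.ite measurableSet_Ioi (measurable_const.sub (gaussCDF_monotone hs).measurable)
    (gaussCDF_monotone hs).measurable

lemma gaussTail_pos {s : ℝ≥0} (hs : s ≠ 0) (y : ℝ) : 0 < gaussTail s y := by
  have h1 := gaussCDF_pos hs y
  have h2 := gaussCDF_lt_one hs y
  unfold gaussTail; split_ifs <;> linarith

lemma gaussTail_lt_one {s : ℝ≥0} (hs : s ≠ 0) (y : ℝ) : gaussTail s y < 1 := by
  have h1 := gaussCDF_pos hs y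
  have h2 := gaussCDF_lt_one hs y
  unfold gaussTail; split_ifs <;> linarith

lemma gaussTail_neg {s : ℝ≥0} (hs : s ≠ 0) {y : ℝ} (hy : y ≠ 0) :
    gaussTail s (-y) = gaussTail s y := by
  unfold gaussTail
  rw [gaussCDF_neg hs]
  rcases lt_or_gt_of_ne hy with h | h
  · simp [h, h.le]
  · simp [h, h.le]

lemma crossSign_neg {y : ℝ} (hy : y ≠ 0) : crossSign (-y) = -crossSign y := by
  unfold crossSign
  rcases lt_or_gt_of_ne hy with h | h
  · simp [h, h.not_gt]
  · simp [h, h.le]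

/-- Chebyshev's inequality plus the trivial bound by `1`. Only integrability over the line matters,
so Gaussian decay is not required. -/
lemma gaussTail_le {s : ℝ≥0} (hs : s ≠ 0) (y : ℝ) : gaussTail s y ≤ (1 + s) * (1 + y ^ 2)⁻¹ := by
  have key : gaussTail s y * y ^ 2 ≤ s := by
    have hL : MemLp (id : ℝ → ℝ) 2 (gaussianReal 0 s) := memLp_id_gaussianReal 2
    have hm : ∫ x, id x ∂(gaussianReal 0 s) = 0 := by simp
    unfold gaussTail
    split_ifs with h
    · rw [one_sub_gaussCDF hs, ← variance_id_gaussianReal (μ := 0) (v := s)]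
      refine real_mul_sq_le_variance hL h.le fun x hx => ?_
      simp only [mem_ofPred_eq]
      rw [hm, sub_zero]
      exact (mem_Ioi.1 hx).le.trans (le_abs_self _)
    · rw [gaussCDF_eq hs, ← variance_id_gaussianReal (μ := 0) (v := s), ← neg_sq]
      push Not at h
      refine real_mul_sq_le_variance hL (by linarith) fun x hx => ?_
      simp only [mem_ofPred_eq]
      rw [hm, sub_zero]
      exact (neg_le_neg (mem_Iic.1 hx)).trans (neg_le_abs _)
  rw [← div_eq_mul_inv, le_div_iff₀ (by positivity)]
  linarith [(gaussTail_lt_one hs y).le]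

lemma integrable_gaussTail {s : ℝ≥0} (hs : s ≠ 0) : Integrable (gaussTail s) := by
  refine (integrable_inv_one_add_sq.const_mul (1 + (s : ℝ))).mono'
    (measurable_gaussTail hs).aestronglyMeasurable (ae_of_all _ fun y => ?_)
  rw [Real.norm_eq_abs, abs_of_pos (gaussTail_pos hs y)]
  exact gaussTail_le hs y

/-! ### The limiting logarithmic moment generating function of the current -/

/-- A particle on the right crosses with probability `1 - Φ(y)` and counts `+1`, one on the left
with probability `Φ(y)` and counts `-1`. Both branches thus become one Bernoulli generating function
with a sign on the tilt. -/
lemma Zfun_eq (s : ℝ≥0) (l y : ℝ) : Zfun s l y = bernCGF (crossSign y * l) (gaussTail s y) := by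
  unfold Zfun bernCGF crossSign gaussTail
  split_ifs
  · congr 1; rw [one_mul]; ring
  · congr 1; rw [neg_one_mul]; ring

lemma measurable_Zfun {s : ℝ≥0} (hs : s ≠ 0) (l : ℝ) : Measurable (Zfun s l) := by
  have : Zfun s l = fun y => bernCGF (crossSign y * l) (gaussTail s y) := funext (Zfun_eq s l)
  rw [this]
  exact measurable_bernCGF.comp ((measurable_crossSign.mul_const l).prodMk (measurable_gaussTail hs))

/-- The integrand of the derivative of `Lam g s`. -/
def lamDensity (g : ℝ → ℝ) (s : ℝ≥0) (l y : ℝ) : ℝ :=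
  crossSign y * siteTilt g (crossSign y * l) (gaussTail s y)

/-- The derivative of `Lam g s`. -/
def lamDeriv (g : ℝ → ℝ) (s : ℝ≥0) (l : ℝ) : ℝ := ∫ y, lamDensity g s l y

lemma abs_comp_Zfun_le {g : ℝ → ℝ} (hg : IsOccupationCGF g) {s : ℝ≥0} (hs : s ≠ 0) (l y : ℝ) :
    |g (Zfun s l y)| ≤ deriv g |l| * Real.exp |l| * gaussTail s y := by
  rw [Zfun_eq]
  exact hg.abs_comp_bernCGF_le (abs_crossSign_mul y l).le (gaussTail_pos hs y).le
    (gaussTail_lt_one hs y).le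

lemma integrable_comp_Zfun {g : ℝ → ℝ} (hg : IsOccupationCGF g) {s : ℝ≥0} (hs : s ≠ 0)
    (l : ℝ) : Integrable fun y => g (Zfun s l y) :=
  ((integrable_gaussTail hs).const_mul (deriv g |l| * Real.exp |l|)).mono'
    (hg.differentiable.continuous.measurable.comp (measurable_Zfun hs l)).aestronglyMeasurable
    (ae_of_all _ fun y => abs_comp_Zfun_le hg hs l y)

lemma measurable_lamDensity {g : ℝ → ℝ} (hg : IsOccupationCGF g) {s : ℝ≥0} (hs : s ≠ 0)
    (l : ℝ) : Measurable (lamDensity g s l) := by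
  have h : Measurable fun y => (crossSign y * l, gaussTail s y) :=
    (measurable_crossSign.mul_const l).prodMk (measurable_gaussTail hs)
  exact measurable_crossSign.mul (((hg.continuous_deriv.measurable.comp
    (measurable_bernCGF.comp h))).mul (measurable_bernTilt.comp h))

lemma abs_lamDensity_le {g : ℝ → ℝ} (hg : IsOccupationCGF g) {s : ℝ≥0} (hs : s ≠ 0)
    {b l : ℝ} (hl : |l| ≤ b) (y : ℝ) :
    |lamDensity g s l y| ≤ deriv g b * Real.exp b * gaussTail s y := by
  have h0 := (gaussTail_pos hs y).le
  have h1 := (gaussTail_lt_one hs y).le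
  rw [lamDensity, abs_mul, abs_crossSign, one_mul, abs_of_nonneg (hg.siteTilt_nonneg h0 h1)]
  exact hg.siteTilt_le ((abs_crossSign_mul y l).le.trans hl) h0 h1

lemma integrable_lamDensity {g : ℝ → ℝ} (hg : IsOccupationCGF g) {s : ℝ≥0} (hs : s ≠ 0)
    (l : ℝ) : Integrable (lamDensity g s l) :=
  ((integrable_gaussTail hs).const_mul (deriv g |l| * Real.exp |l|)).mono'
    (measurable_lamDensity hg hs l).aestronglyMeasurable
    (ae_of_all _ fun y => abs_lamDensity_le hg hs le_rfl y)

lemma hasDerivAt_comp_Zfun {g : ℝ → ℝ} (hg : IsOccupationCGF g) {s : ℝ≥0} (hs : s ≠ 0) (y l : ℝ) :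
    HasDerivAt (fun l => g (Zfun s l y)) (lamDensity g s l y) l := by
  simp_rw [Zfun_eq]
  have h := (hg.hasDerivAt_comp_bernCGF (gaussTail_pos hs y).le (gaussTail_lt_one hs y).le
    (crossSign y * l)).comp l ((hasDerivAt_id l).const_mul (crossSign y))
  refine h.congr_deriv ?_
  rw [lamDensity]
  ring

/-- Differentiation under the integral; on the unit ball around `l` the derivative is dominated by a
multiple of the Gaussian tail, with constants taken at `|l| + 1`. -/
lemma hasDerivAt_Lam {g : ℝ → ℝ} (hg : IsOccupationCGF g) {s : ℝ≥0} (hs : s ≠ 0)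
    (l : ℝ) : HasDerivAt (Lam g s) (lamDeriv g s l) l := by
  refine (hasDerivAt_integral_of_dominated_loc_of_deriv_le (F := fun l y => g (Zfun s l y))
    (F' := lamDensity g s) (s := Metric.ball l 1)
    (bound := fun y => deriv g (|l| + 1) * Real.exp (|l| + 1) * gaussTail s y)
    (Metric.ball_mem_nhds l one_pos)
    (Eventually.of_forall fun x => (integrable_comp_Zfun hg hs x).aestronglyMeasurable)
    (integrable_comp_Zfun hg hs l) (measurable_lamDensity hg hs l).aestronglyMeasurable
    (ae_of_all _ fun y x hx => abs_lamDensity_le hg hs ?_ y)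
    ((integrable_gaussTail hs).const_mul _)
    (ae_of_all _ fun y x _ => hasDerivAt_comp_Zfun hg hs y x)).2
  rw [Metric.mem_ball, Real.dist_eq] at hx
  have := abs_sub_abs_le_abs_sub x l
  linarith

lemma Lam_zero {g : ℝ → ℝ} (hg : IsOccupationCGF g) (s : ℝ≥0) : Lam g s 0 = 0 := by
  simp [Lam, Zfun_eq, bernCGF, hg.zero]

lemma lamDensity_strictMono {g : ℝ → ℝ} (hg : IsOccupationCGF g) {s : ℝ≥0} (hs : s ≠ 0)
    (y : ℝ) : StrictMono fun l => lamDensity g s l y := by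
  intro l m hlm
  have h := hg.siteTilt_strictMono (gaussTail_pos hs y) (gaussTail_lt_one hs y)
  by_cases hy : 0 < y
  · simpa [lamDensity, crossSign, hy] using h hlm
  · simpa [lamDensity, crossSign, hy] using h (neg_lt_neg hlm)

lemma lamDeriv_strictMono {g : ℝ → ℝ} (hg : IsOccupationCGF g) {s : ℝ≥0} (hs : s ≠ 0)
    : StrictMono (lamDeriv g s) := by
  intro l m hlm
  rw [← sub_pos, lamDeriv, lamDeriv,
    ← integral_sub (integrable_lamDensity hg hs m) (integrable_lamDensity hg hs l)]
  have hpos : ∀ y, 0 < lamDensity g s m y - lamDensity g s l y := fun y =>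
    sub_pos.2 (lamDensity_strictMono hg hs y hlm)
  rw [integral_pos_iff_support_of_nonneg (fun y => (hpos y).le)
    ((integrable_lamDensity hg hs m).sub (integrable_lamDensity hg hs l))]
  have : Function.support (fun y => lamDensity g s m y - lamDensity g s l y) = univ :=
    eq_univ_of_forall fun y => (hpos y).ne'
  rw [this]
  simp

/-- The reflection `y ↦ -y` exchanges the two kinds of crossing. The origin, where `crossSign` is
not odd, is a null set. -/
lemma lamDeriv_neg (g : ℝ → ℝ) {s : ℝ≥0} (hs : s ≠ 0)
    (l : ℝ) : lamDeriv g s (-l) = -lamDeriv g s l := by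
  rw [lamDeriv, lamDeriv, ← integral_neg_eq_self, ← integral_neg]
  refine integral_congr_ae ?_
  filter_upwards [compl_mem_ae_iff.2 (measure_singleton (0 : ℝ))] with y hy
  have hy : y ≠ 0 := hy
  simp only [lamDensity, gaussTail_neg hs hy, crossSign_neg hy]
  simp

/-- For large `l` the tilted crossing probability exceeds `1/2` from distance `K`, hence from every
point of `(0, K]`, and there the integrand is at least `γ'(0)/2`. Elsewhere it only increases from
its value at `l = 0`. Since `K` is arbitrary, the derivative is unbounded above. -/
lemma exists_lamDeriv_gt {g : ℝ → ℝ} (hg : IsOccupationCGF g) {s : ℝ≥0} (hs : s ≠ 0)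
    (x : ℝ) : ∃ l, x < lamDeriv g s l := by
  set B := ∫ y, |lamDensity g s 0 y|
  have hB : 0 ≤ B := integral_nonneg fun _ => abs_nonneg _
  have hg0 := hg.deriv_pos 0
  -- `K` is chosen so that the gain `K γ'(0)/2` covers both the distance to `x` and the loss `B`
  -- from subtracting the integrand at `l = 0`.
  obtain ⟨K, hK0, hK⟩ : ∃ K : ℝ, 0 < K ∧ x < lamDeriv g s 0 + (K * (deriv g 0 / 2) - B) := by
    refine ⟨(|x - lamDeriv g s 0| + B + 1) / (deriv g 0 / 2), by positivity, ?_⟩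
    rw [div_mul_cancel₀ _ (by positivity)]
    linarith [le_abs_self (x - lamDeriv g s 0)]
  obtain ⟨l, hl0, hl⟩ := ((eventually_ge_atTop (0 : ℝ)).and
    ((tendsto_bernTilt (gaussTail_pos hs K)).eventually_const_lt
      (show (1 / 2 : ℝ) < 1 by norm_num))).exists
  refine ⟨l, hK.trans_le ?_⟩
  have hint := integrable_lamDensity hg hs
  have h1 : lamDeriv g s l - lamDeriv g s 0 =
      ∫ y, (lamDensity g s l y - lamDensity g s 0 y) := (integral_sub (hint l) (hint 0)).symm
  have hnn : ∀ y, 0 ≤ lamDensity g s l y - lamDensity g s 0 y := fun y =>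
    sub_nonneg.2 ((lamDensity_strictMono hg hs y).monotone hl0)
  have h2 : ∫ y in Ioc 0 K, (deriv g 0 / 2 - |lamDensity g s 0 y|) ≤
      ∫ y in Ioc 0 K, (lamDensity g s l y - lamDensity g s 0 y) := by
    refine setIntegral_mono_on ?_ ((hint l).sub (hint 0)).integrableOn measurableSet_Ioc
      fun y hy => ?_
    · exact (integrable_const _).sub (hint 0).abs.integrableOn
    · refine sub_le_sub ?_ (le_abs_self _)
      have hcs : crossSign y = 1 := if_pos hy.1
      have htail : gaussTail s K ≤ gaussTail s y := by
        simp only [gaussTail, hy.1, hK0, if_true]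
        linarith [gaussCDF_monotone hs hy.2]
      rw [lamDensity, hcs, one_mul, one_mul, siteTilt, div_eq_mul_inv, ← one_div]
      refine mul_le_mul (hg.monotone_deriv (bernCGF_nonneg (gaussTail_pos hs y).le hl0))
        (hl.le.trans (bernTilt_mono_right (gaussTail_pos hs K).le htail (gaussTail_lt_one hs y).le))
        (by norm_num) (hg.deriv_pos _).le
  have h3 : ∫ y in Ioc 0 K, (lamDensity g s l y - lamDensity g s 0 y) ≤
      ∫ y, (lamDensity g s l y - lamDensity g s 0 y) :=
    setIntegral_le_integral ((hint l).sub (hint 0)) (ae_of_all _ hnn)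
  have h4 : ∫ y in Ioc 0 K, (deriv g 0 / 2 - |lamDensity g s 0 y|) =
      K * (deriv g 0 / 2) - ∫ y in Ioc 0 K, |lamDensity g s 0 y| := by
    rw [integral_sub (integrable_const _) (hint 0).abs.integrableOn, setIntegral_const]
    simp [hK0.le]
  have h5 : ∫ y in Ioc 0 K, |lamDensity g s 0 y| ≤ B :=
    setIntegral_le_integral (hint 0).abs (ae_of_all _ fun _ => abs_nonneg _)
  linarith

/-- Oddness turns unboundedness above into unboundedness below; derivatives have the Darboux
property, so continuity of `lamDeriv` is not needed. -/
lemma lamDeriv_surjective {g : ℝ → ℝ} (hg : IsOccupationCGF g) {s : ℝ≥0} (hs : s ≠ 0)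
    : Function.Surjective (lamDeriv g s) := by
  intro x
  obtain ⟨b, hb⟩ := exists_lamDeriv_gt hg hs x
  obtain ⟨c, hc⟩ := exists_lamDeriv_gt hg hs (-x)
  have hc' : lamDeriv g s (-c) < x := by rw [lamDeriv_neg g hs]; linarith
  have h := (ordConnected_univ (α := ℝ)).image_hasDerivWithinAt (f := Lam g s)
    (f' := lamDeriv g s) fun l _ => (hasDerivAt_Lam hg hs l).hasDerivWithinAt
  obtain ⟨a, -, ha⟩ := h.out ⟨-c, mem_univ _, rfl⟩ ⟨b, mem_univ _, rfl⟩ ⟨hc'.le, hb.le⟩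
  exact ⟨a, ha⟩

/-! ### The cost densities -/

lemma density1_eq {g : ℝ → ℝ} (hg : IsOccupationCGF g) (s : ℝ≥0) (a y : ℝ) :
    density1 g s a y = Zfun s a y * deriv g (Zfun s a y) - g (Zfun s a y) :=
  hg.convexDual_deriv _

/-- `F_a` is the exponential tilt of the Bernoulli parameter `Φ(y)` by `-a`, and the relative
entropy of a tilted law is the tilt times its mean minus the logarithm of the normalizer. -/
lemma density2_eq (g : ℝ → ℝ) {s : ℝ≥0} (hs : s ≠ 0) (a y : ℝ) :
    density2 g s a y = a * lamDensity g s a y - Zfun s a y * deriv g (Zfun s a y) := by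
  have hq0 := gaussCDF_pos hs y
  have hq1 := gaussCDF_lt_one hs y
  set q := gaussCDF s y with hq
  have hD : 0 < 1 - q + Real.exp (-a) * q := by
    have := mul_pos (Real.exp_pos (-a)) hq0
    linarith
  have hE : Real.exp a * Real.exp (-a) = 1 := by rw [← Real.exp_add]; simp
  have hF1 : tiltF s a y / q = Real.exp (-a) / (1 - q + Real.exp (-a) * q) := by
    rw [tiltF, ← hq]; field_simp
  have hF2 : (1 - tiltF s a y) / (1 - q) = 1 / (1 - q + Real.exp (-a) * q) := by
    have : 1 - q ≠ 0 := by linarith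
    rw [tiltF, ← hq]; field_simp; ring
  have hBr : bernoulliDual q (tiltF s a y) =
      -a * tiltF s a y - Real.log (1 - q + Real.exp (-a) * q) := by
    rw [bernoulliDual, hF1, hF2, Real.log_div (Real.exp_pos _).ne' hD.ne', Real.log_exp,
      Real.log_div one_ne_zero hD.ne', Real.log_one]
    ring
  suffices h : bernoulliDual q (tiltF s a y) =
      a * (crossSign y * bernTilt (crossSign y * a) (gaussTail s y)) - Zfun s a y by
    rw [density2, ← hq, h, lamDensity, siteTilt, ← Zfun_eq]
    ring
  rw [hBr]
  -- To the right of the origin crossing is the complementary event: the normalizer gains a factor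
  -- `e^a` and the tilted probability becomes `1 - F_a`. The two extra terms `a` cancel.
  by_cases hy : 0 < y
  · have hZ : Zfun s a y = a + Real.log (1 - q + Real.exp (-a) * q) := by
      rw [Zfun, if_pos hy, ← hq]
      nth_rewrite 2 [← Real.log_exp a]
      rw [← Real.log_mul (Real.exp_pos _).ne' hD.ne']
      congr 1
      linear_combination (-q) * hE
    have hT : bernTilt a (1 - q) = 1 - tiltF s a y := by
      have hD' := one_add_exp_sub_pos (l := a) (q := 1 - q) (by linarith) (by linarith)
      rw [bernTilt, tiltF, ← hq, div_eq_iff hD'.ne', sub_mul, div_mul_eq_mul_div, eq_sub_iff_add_eq,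
        ← eq_sub_iff_add_eq', div_eq_iff hD.ne']
      linear_combination (q * (1 - q)) * hE
    simp only [crossSign, gaussTail, hy, if_true, one_mul]
    rw [← hq, hZ, hT]
    ring
  · have hZ : Zfun s a y = Real.log (1 - q + Real.exp (-a) * q) := by
      rw [Zfun, if_neg hy, ← hq, add_comm]
    have hT : bernTilt (-a) q = tiltF s a y := by
      rw [bernTilt, tiltF, ← hq]; congr 1; ring
    simp only [crossSign, gaussTail, hy, if_false, neg_one_mul]
    rw [← hq, hZ, hT]
    ring

lemma integrable_Zfun_mul_deriv {g : ℝ → ℝ} (hg : IsOccupationCGF g) {s : ℝ≥0} (hs : s ≠ 0)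
    (a : ℝ) :
    Integrable fun y => Zfun s a y * deriv g (Zfun s a y) := by
  refine ((integrable_gaussTail hs).const_mul (Real.exp |a| * deriv g |a|)).mono'
    ((measurable_Zfun hs a).mul (hg.continuous_deriv.measurable.comp
      (measurable_Zfun hs a))).aestronglyMeasurable (ae_of_all _ fun y => ?_)
  have h0 := (gaussTail_pos hs y).le
  have h1 := (gaussTail_lt_one hs y).le
  have h2 := abs_bernCGF_le_mul (l := crossSign y * a) h0 h1
  have h3 := abs_bernCGF_le (l := crossSign y * a) h0 h1
  rw [← Zfun_eq, abs_crossSign_mul] at h2 h3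
  rw [norm_mul, Real.norm_eq_abs, Real.norm_eq_abs, abs_of_pos (hg.deriv_pos _)]
  calc |Zfun s a y| * deriv g (Zfun s a y) ≤ (Real.exp |a| * gaussTail s y) * deriv g |a| :=
        mul_le_mul h2 (hg.monotone_deriv ((le_abs_self _).trans h3)) (hg.deriv_pos _).le
          (by positivity)
    _ = _ := by ring

lemma integrable_density1 {g : ℝ → ℝ} (hg : IsOccupationCGF g) {s : ℝ≥0} (hs : s ≠ 0)
    (a : ℝ) : Integrable (density1 g s a) := by
  have : density1 g s a = fun y => Zfun s a y * deriv g (Zfun s a y) - g (Zfun s a y) :=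
    funext (density1_eq hg s a)
  rw [this]
  exact (integrable_Zfun_mul_deriv hg hs a).sub (integrable_comp_Zfun hg hs a)

lemma integrable_density2 {g : ℝ → ℝ} (hg : IsOccupationCGF g) {s : ℝ≥0} (hs : s ≠ 0)
    (a : ℝ) : Integrable (density2 g s a) := by
  have : density2 g s a = fun y => a * lamDensity g s a y - Zfun s a y * deriv g (Zfun s a y) :=
    funext (density2_eq g hs a)
  rw [this]
  exact ((integrable_lamDensity hg hs a).const_mul a).sub (integrable_Zfun_mul_deriv hg hs a)

/-- The terms `Z γ'(Z)` in the two densities cancel pointwise. -/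
lemma rateAtTilt_eq {g : ℝ → ℝ} (hg : IsOccupationCGF g) {s : ℝ≥0} (hs : s ≠ 0)
    (a : ℝ) : rateAtTilt g s a = a * lamDeriv g s a - Lam g s a := by
  rw [rateAtTilt, ← integral_add (integrable_density1 hg hs a) (integrable_density2 hg hs a),
    lamDeriv, Lam, ← integral_const_mul,
    ← integral_sub ((integrable_lamDensity hg hs a).const_mul a) (integrable_comp_Zfun hg hs a)]
  refine integral_congr_ae (ae_of_all _ fun y => ?_)
  simp only [density1_eq hg s, density2_eq g hs]
  ring

/-! ### The compound Poisson laws -/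

lemma lintegral_pmf_toMeasure {β : Type*} [MeasurableSpace β] [MeasurableSingletonClass β]
    [Countable β] (q : PMF β) (f : β → ℝ≥0∞) : ∫⁻ x, f x ∂q.toMeasure = ∑' x, q x * f x := by
  rw [lintegral_countable']
  refine tsum_congr fun x => ?_
  rw [PMF.toMeasure_apply_singleton q x (measurableSet_singleton x), mul_comm]

lemma toMeasure_bind_eq {β : Type*} [MeasurableSpace β] [DiscreteMeasurableSpace β] [Countable β]
    (q : PMF β) (F : β → PMF β) :
    (q.bind F).toMeasure = q.toMeasure.bind fun x => (F x).toMeasure := by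
  ext A hA
  rw [PMF.toMeasure_bind_apply _ _ _ hA, Measure.bind_apply hA .of_discrete,
    lintegral_pmf_toMeasure]

/-- The Laplace transform of the jump kernel. -/
def jumpLaplace (p : PMF ℤ) (θ : ℝ) : ℝ≥0∞ :=
  ∫⁻ x : ℤ, ENNReal.ofReal (Real.exp (θ * x)) ∂p.toMeasure

lemma lintegral_exp_stepPMF (p : PMF ℤ) (θ : ℝ) (k : ℕ) :
    ∫⁻ x : ℤ, ENNReal.ofReal (Real.exp (θ * x)) ∂(stepPMF p k).toMeasure = jumpLaplace p θ ^ k := by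
  induction k with
  | zero =>
    rw [stepPMF, PMF.toMeasure_pure, lintegral_dirac]
    simp
  | succ k ih =>
    rw [stepPMF, toMeasure_bind_eq, Measure.lintegral_bind .of_discrete .of_discrete, pow_succ,
      ← ih, ← lintegral_mul_const _ .of_discrete]
    refine lintegral_congr fun x => ?_
    rw [← PMF.toMeasure_map _ _ .of_discrete, lintegral_map .of_discrete .of_discrete, jumpLaplace,
      ← lintegral_const_mul _ .of_discrete]
    refine lintegral_congr fun y => ?_
    rw [← ENNReal.ofReal_mul (Real.exp_pos _).le, ← Real.exp_add]
    push_cast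
    ring_nf

/-- Averaging the `k`-th power of the jump transform over a Poisson number of jumps gives the
exponential series. -/
lemma lintegral_exp_walkLaw (p : PMF ℤ) (h : ℝ≥0) (θ : ℝ) (hfin : jumpLaplace p θ ≠ ∞) :
    ∫⁻ x : ℤ, ENNReal.ofReal (Real.exp (θ * x)) ∂(walkLaw p h) =
      ENNReal.ofReal (Real.exp (h * ((jumpLaplace p θ).toReal - 1))) := by
  rw [walkLaw, Measure.lintegral_bind .of_discrete .of_discrete]
  simp_rw [lintegral_exp_stepPMF]
  set m := (jumpLaplace p θ).toReal with hm
  have hm0 : 0 ≤ m := ENNReal.toReal_nonneg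
  have hmm : jumpLaplace p θ = ENNReal.ofReal m := (ENNReal.ofReal_toReal hfin).symm
  rw [lintegral_countable']
  have hterm : ∀ k : ℕ, jumpLaplace p θ ^ k * poissonMeasure h {k} =
      ENNReal.ofReal (Real.exp (-h) * ((h * m) ^ k / k.factorial)) := by
    intro k
    rw [poissonMeasure_singleton, hmm, ← ENNReal.ofReal_pow hm0,
      ← ENNReal.ofReal_mul (pow_nonneg hm0 k)]
    congr 1
    rw [mul_pow]
    ring
  simp_rw [hterm]
  have hs := (NormedSpace.expSeries_div_hasSum_exp ((h : ℝ) * m)).mul_left (Real.exp (-h))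
  rw [← ENNReal.ofReal_tsum_of_nonneg (fun k => by positivity) hs.summable, hs.tsum_eq,
    ← Real.exp_eq_exp_ℝ, ← Real.exp_add]
  congr 2
  ring

lemma isProbabilityMeasure_walkLaw (p : PMF ℤ) (h : ℝ≥0) : IsProbabilityMeasure (walkLaw p h) := by
  -- The transform at `θ = 0` is the total mass.
  have h0 : jumpLaplace p 0 = 1 := by simp [jumpLaplace]
  have := lintegral_exp_walkLaw p h 0 (by simp [h0])
  constructor
  simpa [h0] using this

/-- The exponential moment condition on the jump kernel. -/
def HasExpMoments (p : PMF ℤ) : Prop :=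
  ∃ δ : ℝ, 0 < δ ∧ ∀ θ : ℝ, |θ| ≤ δ → Summable fun x : ℤ => Real.exp (θ * x) * (p x).toReal

lemma integrable_toMeasure_iff (p : PMF ℤ) (f : ℤ → ℝ) (hf : ∀ x, 0 ≤ f x) :
    Integrable f p.toMeasure ↔ Summable fun x => f x * (p x).toReal := by
  have h1 : Integrable f p.toMeasure ↔ ∑' x, p x * ENNReal.ofReal (f x) ≠ ∞ := by
    rw [← lintegral_pmf_toMeasure, ← lt_top_iff_ne_top,
      ← hasFiniteIntegral_iff_ofReal (ae_of_all _ hf)]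
    exact ⟨fun h => h.2, fun h => ⟨.of_discrete, h⟩⟩
  rw [h1]
  have h2 : ∀ x, p x * ENNReal.ofReal (f x) = ENNReal.ofReal (f x * (p x).toReal) := fun x => by
    rw [ENNReal.ofReal_mul (hf x), ENNReal.ofReal_toReal (p.apply_ne_top x), mul_comm]
  simp_rw [h2]
  constructor
  · intro h
    have := ENNReal.summable_toReal h
    refine this.congr fun x => ?_
    rw [ENNReal.toReal_ofReal (mul_nonneg (hf x) ENNReal.toReal_nonneg)]
  · intro h
    exact h.tsum_ofReal_ne_top

lemma zero_mem_interior_of_abs_le {S : Set ℝ} {δ : ℝ} (hδ : 0 < δ) (h : ∀ θ, |θ| ≤ δ → θ ∈ S) :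
    (0 : ℝ) ∈ interior S :=
  mem_interior_iff_mem_nhds.2 (Filter.mem_of_superset (Metric.closedBall_mem_nhds 0 hδ)
    fun θ hθ => h θ (by simpa using hθ))

lemma HasExpMoments.integrable {p : PMF ℤ} (hp : HasExpMoments p) :
    ∃ δ : ℝ, 0 < δ ∧ ∀ θ : ℝ, |θ| ≤ δ →
      Integrable (fun x : ℤ => Real.exp (θ * x)) p.toMeasure := by
  obtain ⟨δ, hδ, h⟩ := hp
  exact ⟨δ, hδ, fun θ hθ => (integrable_toMeasure_iff p _ fun x => (Real.exp_pos _).le).2 (h θ hθ)⟩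

lemma jumpLaplace_eq_mgf {p : PMF ℤ} {θ : ℝ}
    (h : Integrable (fun x : ℤ => Real.exp (θ * x)) p.toMeasure) :
    jumpLaplace p θ = ENNReal.ofReal (mgf (fun x : ℤ => (x : ℝ)) p.toMeasure θ) := by
  rw [mgf, ofReal_integral_eq_lintegral_ofReal h (ae_of_all _ fun x => (Real.exp_pos _).le)]
  rfl

lemma walkLaw_exp {p : PMF ℤ} (h : ℝ≥0) {θ : ℝ}
    (hθ : Integrable (fun x : ℤ => Real.exp (θ * x)) p.toMeasure) :
    Integrable (fun x : ℤ => Real.exp (θ * x)) (walkLaw p h) ∧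
      cgf (fun x : ℤ => (x : ℝ)) (walkLaw p h) θ =
        h * (mgf (fun x : ℤ => (x : ℝ)) p.toMeasure θ - 1) := by
  have h1 := jumpLaplace_eq_mgf hθ
  have h2 := lintegral_exp_walkLaw p h θ (by simp [h1])
  rw [h1, ENNReal.toReal_ofReal mgf_nonneg] at h2
  constructor
  · refine ⟨.of_discrete, ?_⟩
    rw [hasFiniteIntegral_iff_ofReal (ae_of_all _ fun x => (Real.exp_pos _).le), h2]
    exact ENNReal.ofReal_lt_top
  · rw [cgf, mgf, integral_eq_lintegral_of_nonneg_ae (ae_of_all _ fun x => (Real.exp_pos _).le)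
      .of_discrete, h2, ENNReal.toReal_ofReal (Real.exp_pos _).le, Real.log_exp]

lemma jumpMean_eq {p : PMF ℤ} (hp : HasExpMoments p) :
    jumpMean p = ∫ x : ℤ, (x : ℝ) ∂p.toMeasure := by
  obtain ⟨δ, hδ, h⟩ := hp.integrable
  have h0 := zero_mem_interior_of_abs_le (S := integrableExpSet (fun x : ℤ => (x : ℝ)) p.toMeasure)
    hδ h
  rw [PMF.integral_eq_tsum _ _ (by simpa using integrable_pow_of_mem_interior_integrableExpSet h0 1),
    jumpMean]
  simp [mul_comm]

lemma integrable_sq_jump {p : PMF ℤ} (hp : HasExpMoments p) :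
    Integrable (fun x : ℤ => (x : ℝ) ^ 2) p.toMeasure := by
  obtain ⟨δ, hδ, h⟩ := hp.integrable
  have h0 := zero_mem_interior_of_abs_le (S := integrableExpSet (fun x : ℤ => (x : ℝ)) p.toMeasure)
    hδ h
  exact integrable_pow_of_mem_interior_integrableExpSet h0 2

lemma jumpSecondMoment_eq {p : PMF ℤ} (hp : HasExpMoments p) :
    jumpSecondMoment p = ∫ x : ℤ, (x : ℝ) ^ 2 ∂p.toMeasure := by
  rw [PMF.integral_eq_tsum _ _ (integrable_sq_jump hp), jumpSecondMoment]
  simp [mul_comm]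

lemma jumpSecondMoment_nonneg (p : PMF ℤ) : 0 ≤ jumpSecondMoment p :=
  tsum_nonneg fun _ => mul_nonneg (sq_nonneg _) ENNReal.toReal_nonneg

lemma jumpSecondMoment_pos {p : PMF ℤ} (hp : HasExpMoments p) (h0 : p 0 ≠ 1) :
    0 < jumpSecondMoment p := by
  have hsum := (integrable_toMeasure_iff p _ fun x => sq_nonneg (x : ℝ)).1 (integrable_sq_jump hp)
  obtain ⟨x, hx0, hx⟩ : ∃ x : ℤ, x ≠ 0 ∧ p x ≠ 0 := by
    by_contra! hcon
    apply h0
    rw [← p.tsum_coe, tsum_eq_single 0 hcon]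
  refine hsum.tsum_pos (fun _ => mul_nonneg (sq_nonneg _) ENNReal.toReal_nonneg) x ?_
  have := ENNReal.toReal_pos hx (p.apply_ne_top x)
  positivity

/-- Near zero the cumulant generating function is `h (mgf p - 1)`, so the cumulants of the walk are
`h` times the raw moments of the jump law. This is why the variance involves `κ₂` rather than the
variance of a jump. -/
lemma walkLaw_moments {p : PMF ℤ} (hp : HasExpMoments p) (h : ℝ≥0) :
    MemLp (fun x : ℤ => (x : ℝ)) 2 (walkLaw p h) ∧
    ∫ x : ℤ, (x : ℝ) ∂(walkLaw p h) = h * jumpMean p ∧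
    variance (fun x : ℤ => (x : ℝ)) (walkLaw p h) = h * jumpSecondMoment p := by
  have hprob := isProbabilityMeasure_walkLaw p h
  obtain ⟨δ, hδ, hint⟩ := hp.integrable
  set c : ℤ → ℝ := fun x => (x : ℝ) with hc
  have h0 : 0 ∈ interior (integrableExpSet c (walkLaw p h)) :=
    zero_mem_interior_of_abs_le hδ fun θ hθ => (walkLaw_exp h (hint θ hθ)).1
  have h0' : 0 ∈ interior (integrableExpSet c p.toMeasure) := zero_mem_interior_of_abs_le hδ hint
  have hev : cgf c (walkLaw p h) =ᶠ[𝓝 0] fun θ => h * (mgf c p.toMeasure θ - 1) := by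
    filter_upwards [Metric.closedBall_mem_nhds (0 : ℝ) hδ] with θ hθ
    exact (walkLaw_exp h (hint θ (by simpa using hθ))).2
  have hd : ∀ᶠ θ in 𝓝 (0 : ℝ), deriv (cgf c (walkLaw p h)) θ = h * deriv (mgf c p.toMeasure) θ := by
    filter_upwards [hev.deriv, isOpen_interior.mem_nhds h0'] with θ h1 h2
    rw [h1]
    exact (((hasDerivAt_mgf h2).sub_const 1).const_mul (h : ℝ)).deriv.trans
      (by rw [(hasDerivAt_mgf h2).deriv])
  refine ⟨memLp_of_mem_interior_integrableExpSet h0 2, ?_, ?_⟩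
  · have := deriv_cgf_zero h0
    rw [hd.self_of_nhds, deriv_mgf_zero h0'] at this
    rw [jumpMean_eq hp]
    simpa using this.symm
  · have h1 := variance_tilted_mul h0
    simp only [zero_mul, tilted_const] at h1
    rw [h1, iteratedDeriv_succ, iteratedDeriv_one, Filter.EventuallyEq.deriv_eq hd,
      jumpSecondMoment_eq hp]
    have h2 := hasDerivAt_iteratedDeriv_mgf h0' 1
    rw [iteratedDeriv_one] at h2
    rw [(h2.const_mul (h : ℝ)).deriv]
    simp [hc]

/-! ### The central limit theorem for the walks -/

/-- The displacement over `[0, n t]` is a sum of `n` i.i.d. increments over time `t`. The conclusion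
concerns only `walkLaw`; the walk `X` supplies a space carrying these increments. -/
theorem IsRandomWalk.tendsto_walkLaw {Ω : Type*} [MeasurableSpace Ω] {P : Measure Ω}
    [IsProbabilityMeasure P] {p : PMF ℤ} {m : ℤ} {X : ℝ≥0 → Ω → ℤ} (hX : IsRandomWalk P p m X)
    (hp : HasExpMoments p) {t s : ℝ≥0} (hs : s = (jumpSecondMoment p).toNNReal * t) (hs0 : s ≠ 0)
    {c : ℕ → ℝ} {c₀ : ℝ} (hc : Tendsto c atTop (𝓝 c₀)) :
    Tendsto (fun n : ℕ => (walkLaw p (n * t)).real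
      {x : ℤ | (x : ℝ) - n * (t * jumpMean p) ≤ √(n : ℝ) * c n}) atTop (𝓝 (gaussCDF s c₀)) := by
  obtain ⟨hL, hmean, hvar⟩ := walkLaw_moments hp t
  set Z : ℕ → Ω → ℝ := fun k ω => ((X ((k + 1 : ℕ) * t) ω - X (k * t) ω : ℤ) : ℝ) with hZ
  have hlaw : ∀ k, HasLaw (fun ω => X ((k + 1 : ℕ) * t) ω - X (k * t) ω) (walkLaw p t) P := by
    intro k
    have := hX.increment_law (k * t) t
    have e : (k * t + t : ℝ≥0) = (k + 1 : ℕ) * t := by push_cast; ring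
    rwa [e] at this
  have hcast : Measurable (fun x : ℤ => (x : ℝ)) := .of_discrete
  have hmono : Monotone fun k : ℕ => (k * t : ℝ≥0) := fun a b hab => by
    simp only
    gcongr
  have hindep : iIndepFun Z P := (hX.indep_increments.nat hmono).comp (fun _ x => (x : ℝ))
    fun _ => hcast
  have hmap : ∀ k, P.map (Z k) = (walkLaw p t).map fun x : ℤ => (x : ℝ) := by
    intro k
    rw [← (hlaw k).map_eq, AEMeasurable.map_map_of_aemeasurable hcast.aemeasurable
      (hlaw k).aemeasurable]
    rfl
  have haem : ∀ k, AEMeasurable (Z k) P := fun k => hcast.comp_aemeasurable (hlaw k).aemeasurable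
  have hident : ∀ k, IdentDistrib (Z k) (Z 0) P P := fun k =>
    ⟨haem k, haem 0, by rw [hmap, hmap]⟩
  have hid : IdentDistrib (Z 0) (fun x : ℤ => (x : ℝ)) P (walkLaw p t) :=
    ⟨haem 0, hcast.aemeasurable, hmap 0⟩
  have hmeanZ : P[Z 0] = t * jumpMean p := by rw [← hmean]; exact hid.integral_eq
  have hvarZ : (variance (Z 0) P).toNNReal = s := by
    rw [hid.variance_eq, hvar, hs, mul_comm, Real.toNNReal_mul (jumpSecondMoment_nonneg p)]
    simp
  have hclt := tendstoInDistribution_inv_sqrt_mul_sum_sub (P := P) (X := Z) (Y := id)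
    (P' := gaussianReal 0 s) (by rw [hvarZ]; exact HasLaw.id) (hid.memLp_iff.2 hL) hindep hident
  -- Slutsky's theorem moves the varying threshold `c n` into the variable, so that weak convergence
  -- is tested on the fixed half-line `Iic 0`, whose boundary is null for the limit.
  have hsl := hclt.add_of_tendstoInMeasure_const (Y := fun n _ => -c n) (c := -c₀)
    (tendstoInMeasure_of_tendsto_ae (fun _ => aestronglyMeasurable_const)
      (ae_of_all _ fun _ => hc.neg)) (fun _ => aemeasurable_const)
  have hnull := nullSingletonClass_gaussianReal (μ := 0) hs0
  have hZmap : (gaussianReal 0 s).map (fun ω => id ω + -c₀) = gaussianReal (-c₀) s := by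
    simpa using gaussianReal_map_add_const (μ := 0) (v := s) (-c₀)
  have hport := ProbabilityMeasure.tendsto_measure_of_null_frontier_of_tendsto' hsl.tendsto
    (E := Iic 0) (by
      have := nullSingletonClass_gaussianReal (μ := -c₀) hs0
      rw [frontier_Iic]
      exact (congrArg (fun ρ : Measure ℝ => ρ {0}) hZmap).trans (measure_singleton 0))
  have hprob : IsProbabilityMeasure ((gaussianReal 0 s).map fun ω => id ω + -c₀) := by
    rw [hZmap]; infer_instance
  have hreal := (ENNReal.tendsto_toReal
    (measure_ne_top ((gaussianReal 0 s).map fun ω => id ω + -c₀) (Iic 0))).comp hport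
  have hlim : ((gaussianReal 0 s).map (fun ω => id ω + -c₀) (Iic 0)).toReal = gaussCDF s c₀ := by
    rw [Measure.map_apply (by fun_prop) measurableSet_Iic, gaussCDF_eq hs0]
    congr 2
    ext x
    simp
  simp only [ProbabilityMeasure.coe_mk, Function.comp_def] at hreal
  rw [hlim] at hreal
  refine hreal.congr' ?_
  filter_upwards [eventually_gt_atTop 0] with n hn
  have hn' : (0 : ℝ) < √(n : ℝ) := Real.sqrt_pos.2 (by exact_mod_cast hn)
  have hincr := hX.increment_law 0 (n * t)
  rw [zero_add] at hincr
  rw [measureReal_def, ← hincr.map_eq, Measure.map_apply_of_aemeasurable hincr.aemeasurable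
    (MeasurableSet.of_discrete), Measure.map_apply_of_aemeasurable (hsl.forall_aemeasurable n)
    measurableSet_Iic]
  congr 2
  ext ω
  simp only [mem_preimage, Pi.add_apply, mem_Iic, mem_ofPred_eq, hmeanZ]
  simp only [hZ]
  have htel : ∑ k ∈ Finset.range n, ((X ((k + 1 : ℕ) * t) ω - X (k * t) ω : ℤ) : ℝ) =
      ((X (n * t) ω - X 0 ω : ℤ) : ℝ) := by
    rw [← Int.cast_sum, Finset.sum_range_sub fun k : ℕ => X (k * t) ω]
    simp
  rw [htel, ← sub_eq_add_neg, sub_nonpos, inv_mul_le_iff₀ hn']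

/-! ### Exponential moments of the numbers of crossing particles -/

/-- The displacements that carry a particle started at distance `k` from the origin of the
characteristic across it. -/
def crossSet (B k : ℤ) : Set ℤ := if 0 < k then Iic (B - k) else Ioi (B - k)

/-- The probability that a particle started at distance `k` crosses the characteristic. -/
def crossProb (p : PMF ℤ) (h : ℝ≥0) (B k : ℤ) : ℝ := (walkLaw p h).real (crossSet B k)

/-- The number of particles started at `m` that cross the characteristic by time `h`. -/
def crossCount (B K : ℤ) (h : ℝ≥0) (η : ℤ → ℕ) (X : ℤ → ℕ → ℝ≥0 → ℤ) (m : ℤ) : ℝ :=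
  ∑ j ∈ Finset.range (η m), (crossSet B (m - K)).indicator 1 (X m j h - X m j 0)

lemma crossCount_nonneg (B K : ℤ) (h : ℝ≥0) (η : ℤ → ℕ) (X : ℤ → ℕ → ℝ≥0 → ℤ) (m : ℤ) :
    0 ≤ crossCount B K h η X m :=
  Finset.sum_nonneg fun _ _ => indicator_nonneg (fun _ _ => zero_le_one) _

/-- The side of the starting site fixes which of the two indicators can be nonzero, so all particles
of a site share one sign. The characteristic itself, `m = K`, belongs to the left side. -/
lemma siteCurrent_eq (v : ℝ) (η : ℤ → ℕ) (X : ℤ → ℕ → ℝ≥0 → ℤ) (n : ℕ) (t : ℝ≥0) (r : ℝ) (m : ℤ)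
    (hX : ∀ j, X m j 0 = m) :
    siteCurrent v η X n t r m = crossSign ((m - ⌊r * √(n : ℝ)⌋ : ℤ) : ℝ) *
      crossCount ⌊(n : ℝ) * v * t⌋ ⌊r * √(n : ℝ)⌋ (n * t) η X m := by
  rw [siteCurrent, crossCount, Finset.mul_sum]
  refine Finset.sum_congr rfl fun j _ => ?_
  rw [hX]
  set K := ⌊r * √(n : ℝ)⌋
  set B := ⌊(n : ℝ) * v * t⌋
  set x := X m j (n * t)
  have hcs : crossSign ((m - K : ℤ) : ℝ) = if 0 < m - K then 1 else -1 := by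
    simp only [crossSign, Int.cast_pos]
  rw [hcs]
  by_cases hm : K < m
  · have h1 : 0 < m - K := by lia
    by_cases hx : x ≤ B + K
    · have h2 : x - m ∈ crossSet B (m - K) := by simp only [crossSet, h1, if_true, mem_Iic]; lia
      simp [hm, hx, h2, hm.not_ge]
    · have h2 : x - m ∉ crossSet B (m - K) := by simp only [crossSet, h1, if_true, mem_Iic]; lia
      simp [hm, hx, h2, hm.not_ge]
  · have h1 : ¬ 0 < m - K := by lia
    by_cases hx : x ≤ B + K
    · have h2 : x - m ∉ crossSet B (m - K) := by simp only [crossSet, h1, if_false, mem_Ioi]; lia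
      simp [hm, h2, hx.not_gt]
    · have h2 : x - m ∈ crossSet B (m - K) := by simp only [crossSet, h1, if_false, mem_Ioi]; lia
      simp only [hm, and_false, if_false, not_lt.1 hm, and_true, not_le.1 hx, if_true, h1, h2,
        indicator_of_mem, Pi.one_apply]
      norm_num

lemma crossProb_nonneg (p : PMF ℤ) (h : ℝ≥0) (B k : ℤ) : 0 ≤ crossProb p h B k := measureReal_nonneg

lemma crossProb_le_one (p : PMF ℤ) (h : ℝ≥0) (B k : ℤ) : crossProb p h B k ≤ 1 :=
  have := isProbabilityMeasure_walkLaw p h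
  measureReal_le_one

lemma lintegral_exp_indicator {β : Type*} [MeasurableSpace β] (μ : Measure β)
    [IsProbabilityMeasure μ] {A : Set β} (hA : MeasurableSet A) (θ : ℝ) :
    ∫⁻ x, ENNReal.ofReal (Real.exp (θ * A.indicator 1 x)) ∂μ =
      ENNReal.ofReal (Real.exp (bernCGF θ (μ.real A))) := by
  have hpos := one_add_exp_sub_pos (l := θ) (measureReal_nonneg (μ := μ) (s := A)) measureReal_le_one
  have h1 : ∀ x, ENNReal.ofReal (Real.exp (θ * A.indicator 1 x)) =
      A.indicator (fun _ => ENNReal.ofReal (Real.exp θ)) x + Aᶜ.indicator (fun _ => 1) x := by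
    intro x
    by_cases hx : x ∈ A <;> simp [hx]
  simp_rw [h1]
  rw [lintegral_add_left (measurable_const.indicator hA), lintegral_indicator hA,
    lintegral_indicator hA.compl, setLIntegral_const, setLIntegral_const, one_mul, bernCGF,
    Real.exp_log hpos, ← ofReal_measureReal, ← ofReal_measureReal, ← ENNReal.ofReal_mul
    (Real.exp_pos _).le, ← ENNReal.ofReal_add (by positivity) measureReal_nonneg,
    probReal_compl_eq_one_sub hA]
  congr 1
  ring

lemma lintegral_exp_occupation {ν : Measure ℕ} [IsProbabilityMeasure ν]
    (hν : ∀ θ : ℝ, Integrable (fun k : ℕ => Real.exp (θ * k)) ν) (b : ℝ) :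
    ∫⁻ k : ℕ, ENNReal.ofReal (Real.exp b) ^ k ∂ν = ENNReal.ofReal (Real.exp (occCGF ν b)) := by
  have hpos : 0 < ∫ k : ℕ, Real.exp (b * k) ∂ν := integral_exp_pos (hν b)
  rw [occCGF, Real.exp_log hpos,
    ofReal_integral_eq_lintegral_ofReal (hν b) (ae_of_all _ fun _ => (Real.exp_pos _).le)]
  refine lintegral_congr fun k => ?_
  rw [← ENNReal.ofReal_pow (Real.exp_pos _).le, ← Real.exp_nat_mul, mul_comm]

lemma measurable_prod_range {β : Type*} [MeasurableSpace β] {g : ℕ → β → ℝ≥0∞}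
    (hg : ∀ j, Measurable (g j)) : Measurable fun z : ℕ × β => ∏ j ∈ Finset.range z.1, g j z.2 := by
  refine measurable_from_prod_countable_right fun k => ?_
  exact Finset.measurable_fun_prod (Finset.range k) fun j _ => hg j

lemma measurable_prod_sites (T : Finset ℤ) (f : ℤ → ℤ → ℝ≥0∞) (h : ℝ≥0) :
    Measurable fun z : (ℤ → ℕ) × (ℤ × ℕ → ℝ≥0 → ℤ) =>
      ∏ m ∈ T, ∏ j ∈ Finset.range (z.1 m), f m (z.2 (m, j) h) := by
  refine Finset.measurable_fun_prod _ fun m _ => ?_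
  have h1 : ∀ j : ℕ, Measurable fun d : ℤ × ℕ → ℝ≥0 → ℤ => f m (d (m, j) h) := fun j =>
    (Measurable.of_discrete (f := f m)).comp
      ((measurable_pi_apply h).comp (measurable_pi_apply (m, j)))
  have h2 : Measurable fun z : (ℤ → ℕ) × (ℤ × ℕ → ℝ≥0 → ℤ) => (z.1 m, z.2) :=
    ((measurable_pi_apply m).comp measurable_fst).prodMk measurable_snd
  exact (measurable_prod_range h1).comp h2

/-- Conditioning on the occupation numbers turns each site into `exp(bernCGF)` to the power `η m`,
and averaging over the independent occupations gives `occCGF`. The tilt may vary with the site,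
which leaves room for the sign of the crossing. -/
theorem IsWalkSystem.lintegral_exp_sum {Ω : Type*} [MeasurableSpace Ω] {P : Measure Ω}
    [IsProbabilityMeasure P] {p : PMF ℤ} {ν : Measure ℕ} [IsProbabilityMeasure ν] {η : ℤ → Ω → ℕ}
    {X : ℤ → ℕ → ℝ≥0 → Ω → ℤ} (hsys : IsWalkSystem P p ν η X)
    (hν : ∀ θ : ℝ, Integrable (fun k : ℕ => Real.exp (θ * k)) ν) (B K : ℤ) (h : ℝ≥0)
    (T : Finset ℤ) (θ : ℤ → ℝ) :
    ∫⁻ ω, ENNReal.ofReal (Real.exp (∑ m ∈ T, θ m *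
        crossCount B K h (fun m => η m ω) (fun m j u => X m j u ω) m)) ∂P =
      ENNReal.ofReal (Real.exp (∑ m ∈ T,
        occCGF ν (bernCGF (θ m) (crossProb p h B (m - K))))) := by
  have hwp := isProbabilityMeasure_walkLaw p h
  set f : ℤ → ℤ → ℝ≥0∞ := fun m x =>
    ENNReal.ofReal (Real.exp (θ m * (crossSet B (m - K)).indicator 1 x)) with hf
  set D : Ω → ℤ × ℕ → ℝ≥0 → ℤ := fun ω i t => X i.1 i.2 t ω - X i.1 i.2 0 ω with hD
  set F : (ℤ → ℕ) × (ℤ × ℕ → ℝ≥0 → ℤ) → ℝ≥0∞ := fun z =>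
    ∏ m ∈ T, ∏ j ∈ Finset.range (z.1 m), f m (z.2 (m, j) h) with hF
  have hDm : Measurable D := measurable_pi_lambda _ fun i => measurable_pi_lambda _ fun t =>
    ((hsys.walk i.1 i.2).measurable t).sub ((hsys.walk i.1 i.2).measurable 0)
  have hηm : Measurable fun (ω : Ω) (m : ℤ) => η m ω := measurable_pi_lambda _ hsys.occ_measurable
  have hfm : ∀ m, Measurable (f m) := fun m => .of_discrete
  have hFm : Measurable F := measurable_prod_sites T f h
  have hlhs : ∀ ω, ENNReal.ofReal (Real.exp (∑ m ∈ T, θ m *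
      crossCount B K h (fun m => η m ω) (fun m j u => X m j u ω) m)) =
      F (fun m => η m ω, D ω) := by
    intro ω
    simp only [hF, hf, hD, crossCount, Finset.mul_sum]
    rw [Real.exp_sum, ENNReal.ofReal_prod_of_nonneg fun _ _ => (Real.exp_pos _).le]
    refine Finset.prod_congr rfl fun m _ => ?_
    rw [Real.exp_sum, ENNReal.ofReal_prod_of_nonneg fun _ _ => (Real.exp_pos _).le]
  simp_rw [hlhs]
  have hprod := (indepFun_iff_map_prod_eq_prod_map_map hηm.aemeasurable hDm.aemeasurable).1
    hsys.occ_walk_indep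
  have hPη : IsProbabilityMeasure (P.map fun (ω : Ω) (m : ℤ) => η m ω) :=
    Measure.isProbabilityMeasure_map hηm.aemeasurable
  have hPD : IsProbabilityMeasure (P.map D) := Measure.isProbabilityMeasure_map hDm.aemeasurable
  have hinner : ∀ e : ℤ → ℕ, ∫⁻ d, F (e, d) ∂(P.map D) =
      ∏ m ∈ T, ENNReal.ofReal (Real.exp (bernCGF (θ m) (crossProb p h B (m - K)))) ^ e m := by
    intro e
    rw [lintegral_map (f := fun d => F (e, d)) (hFm.comp measurable_prodMk_left) hDm]
    -- Indexing by dependent pairs makes the double product over sites and particles one finite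
    -- product of independent factors.
    have hind : iIndepFun (fun (i : Σ _ : ℤ, ℕ) ω => f i.1 (D ω (i.1, i.2) h)) P :=
      (hsys.walk_indep.precomp (g := fun i : Σ _ : ℤ, ℕ => (i.1, i.2)) (by
        rintro ⟨a, b⟩ ⟨c, d⟩ hcd
        simp only [Prod.mk.injEq] at hcd
        simp [hcd])).comp (fun i d => f i.1 (d h))
        fun i => (hfm i.1).comp (measurable_pi_apply h)
    have h1 := lintegral_prod_eq_prod_lintegral_of_indepFun
      (T.sigma fun m => Finset.range (e m)) _ hind fun i => (hfm i.1).comp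
        ((measurable_pi_apply h).comp ((measurable_pi_apply _).comp hDm))
    simp only [hF]
    simp_rw [Finset.prod_sigma] at h1
    rw [h1]
    refine Finset.prod_congr rfl fun m _ => ?_
    rw [Finset.prod_congr rfl (g := fun _ =>
      ENNReal.ofReal (Real.exp (bernCGF (θ m) (crossProb p h B (m - K))))), Finset.prod_const,
      Finset.card_range]
    intro j _
    have hl := (hsys.walk m j).increment_law 0 h
    rw [zero_add] at hl
    rw [crossProb, ← lintegral_exp_indicator (walkLaw p h) .of_discrete, ← hl.map_eq,
      lintegral_map' (AEMeasurable.of_discrete) hl.aemeasurable]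
  calc ∫⁻ ω, F (fun m => η m ω, D ω) ∂P
      = ∫⁻ z, F z ∂(P.map fun ω => ((fun m => η m ω), D ω)) :=
        (lintegral_map hFm (hηm.prodMk hDm)).symm
    _ = ∫⁻ e, ∫⁻ d, F (e, d) ∂(P.map D) ∂(P.map fun (ω : Ω) (m : ℤ) => η m ω) := by
        rw [hprod, lintegral_prod _ hFm.aemeasurable]
    _ = ∫⁻ ω, ∏ m ∈ T, ENNReal.ofReal
          (Real.exp (bernCGF (θ m) (crossProb p h B (m - K)))) ^ η m ω ∂P := by
        simp_rw [hinner]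
        rw [lintegral_map _ hηm]
        exact Finset.measurable_fun_prod _ fun m _ =>
          (Measurable.of_discrete (f := fun k : ℕ => ENNReal.ofReal
            (Real.exp (bernCGF (θ m) (crossProb p h B (m - K)))) ^ k)).comp (measurable_pi_apply m)
    _ = ∏ m ∈ T, ∫⁻ ω, ENNReal.ofReal
          (Real.exp (bernCGF (θ m) (crossProb p h B (m - K)))) ^ η m ω ∂P :=
        lintegral_prod_eq_prod_lintegral_of_indepFun T _
          (hsys.occ_indep.comp (fun m (k : ℕ) => ENNReal.ofReal
            (Real.exp (bernCGF (θ m) (crossProb p h B (m - K)))) ^ k) fun _ => .of_discrete)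
          fun m => (Measurable.of_discrete (f := fun k : ℕ => ENNReal.ofReal
            (Real.exp (bernCGF (θ m) (crossProb p h B (m - K)))) ^ k)).comp (hsys.occ_measurable m)
    _ = _ := by
        rw [Real.exp_sum, ENNReal.ofReal_prod_of_nonneg fun _ _ => (Real.exp_pos _).le]
        refine Finset.prod_congr rfl fun m _ => ?_
        rw [← lintegral_exp_occupation hν, ← (hsys.occ_law m).map_eq,
          lintegral_map .of_discrete (hsys.occ_measurable m)]

/-! ### Exponential moments of infinite sums -/

/-- The sites in `[-N, N]`. -/
def siteBox (N : ℕ) : Finset ℤ := Finset.Icc (-(N : ℤ)) N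

lemma siteBox_mono : Monotone siteBox := fun M N h =>
  Finset.Icc_subset_Icc (by lia) (by lia)

lemma tendsto_siteBox : Tendsto siteBox atTop atTop :=
  tendsto_atTop_finset_of_monotone siteBox_mono fun m =>
    ⟨m.natAbs, by simp only [siteBox, Finset.mem_Icc]; lia⟩

section InfiniteSum

variable {Ω : Type*} [MeasurableSpace Ω] {P : Measure Ω} {V : ℤ → Ω → ℝ}

/-- For `b ≥ 0` the partial sums increase, so monotone convergence applies, and their exponential
moments are at most `exp (∑ u)`. The supremum later serves as the dominating function. -/
lemma lintegral_iSup_exp_sum_ne_top (hV : ∀ m, Measurable (V m)) (hV0 : ∀ m ω, 0 ≤ V m ω)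
    {ψ : ℝ → ℤ → ℝ}
    (hmgf : ∀ (T : Finset ℤ) (θ : ℤ → ℝ),
      ∫⁻ ω, ENNReal.ofReal (Real.exp (∑ m ∈ T, θ m * V m ω)) ∂P =
      ENNReal.ofReal (Real.exp (∑ m ∈ T, ψ (θ m) m)))
    (hψ : ∀ b : ℝ, ∃ u : ℤ → ℝ, Summable u ∧ ∀ m θ, |θ| ≤ b → |ψ θ m| ≤ u m) {b : ℝ} (hb : 0 ≤ b) :
    ∫⁻ ω, ⨆ N, ENNReal.ofReal (Real.exp (∑ m ∈ siteBox N, b * V m ω)) ∂P ≠ ∞ := by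
  obtain ⟨u, hu, hψu⟩ := hψ b
  rw [lintegral_iSup]
  · refine ne_top_of_le_ne_top (ENNReal.ofReal_ne_top (r := Real.exp (∑' m, u m)))
      (iSup_le fun N => ?_)
    rw [hmgf (siteBox N) fun _ => b]
    refine ENNReal.ofReal_le_ofReal (Real.exp_le_exp.2 ?_)
    have h1 : ∀ m, |ψ b m| ≤ u m := fun m => hψu m b (abs_of_nonneg hb).le
    exact (Finset.sum_le_sum fun m _ => (le_abs_self _).trans (h1 m)).trans
      (hu.sum_le_tsum _ fun m _ => (abs_nonneg _).trans (h1 m))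
  · exact fun N => ((Real.measurable_exp.comp (Finset.measurable_fun_sum _ fun m _ =>
      (hV m).const_mul b))).ennreal_ofReal
  · intro M N hMN ω
    refine ENNReal.ofReal_le_ofReal (Real.exp_le_exp.2 ?_)
    exact Finset.sum_le_sum_of_subset_of_nonneg (siteBox_mono hMN) fun m _ _ =>
      mul_nonneg hb (hV0 m ω)

/-- The exponentials of the partial sums have an almost surely finite supremum, and `x ≤ e^x` bounds
the sums themselves. -/
lemma ae_summable_of_exp_moments (hV : ∀ m, Measurable (V m)) (hV0 : ∀ m ω, 0 ≤ V m ω)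
    {ψ : ℝ → ℤ → ℝ}
    (hmgf : ∀ (T : Finset ℤ) (θ : ℤ → ℝ),
      ∫⁻ ω, ENNReal.ofReal (Real.exp (∑ m ∈ T, θ m * V m ω)) ∂P =
      ENNReal.ofReal (Real.exp (∑ m ∈ T, ψ (θ m) m)))
    (hψ : ∀ b : ℝ, ∃ u : ℤ → ℝ, Summable u ∧ ∀ m θ, |θ| ≤ b → |ψ θ m| ≤ u m) :
    ∀ᵐ ω ∂P, Summable fun m => V m ω := by
  have hfin := lintegral_iSup_exp_sum_ne_top hV hV0 hmgf hψ zero_le_one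
  have hmeas : Measurable fun ω => ⨆ N, ENNReal.ofReal (Real.exp (∑ m ∈ siteBox N, 1 * V m ω)) :=
    Measurable.iSup fun N => ((Real.measurable_exp.comp (Finset.measurable_fun_sum _ fun m _ =>
      (hV m).const_mul 1))).ennreal_ofReal
  filter_upwards [ae_lt_top hmeas hfin] with ω hω
  refine summable_of_sum_le (fun m => hV0 m ω)
    (c := (⨆ N, ENNReal.ofReal (Real.exp (∑ m ∈ siteBox N, 1 * V m ω))).toReal) fun T => ?_
  obtain ⟨N, hN⟩ := (tendsto_siteBox.eventually_ge_atTop T).exists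
  have h1 : ENNReal.ofReal (Real.exp (∑ m ∈ siteBox N, 1 * V m ω)) ≤ _ :=
    le_iSup (fun N => ENNReal.ofReal (Real.exp (∑ m ∈ siteBox N, 1 * V m ω))) N
  have h2 := (ENNReal.ofReal_le_iff_le_toReal hω.ne).1 h1
  calc ∑ m ∈ T, V m ω ≤ ∑ m ∈ siteBox N, 1 * V m ω := by
        simp_rw [one_mul]
        exact Finset.sum_le_sum_of_subset_of_nonneg hN fun m _ _ => hV0 m ω
    _ ≤ Real.exp (∑ m ∈ siteBox N, 1 * V m ω) := by
        linarith [Real.add_one_le_exp (∑ m ∈ siteBox N, 1 * V m ω)]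
    _ ≤ _ := h2

lemma aemeasurable_tsum_of_ae_summable (hV : ∀ m, Measurable (V m))
    (hsum : ∀ᵐ ω ∂P, Summable fun m => V m ω) {θ : ℤ → ℝ} {b : ℝ} (hθ : ∀ m, |θ m| ≤ b)
    (hV0 : ∀ m ω, 0 ≤ V m ω) :
    (∀ᵐ ω ∂P, Tendsto (fun N => ∑ m ∈ siteBox N, θ m * V m ω) atTop
      (𝓝 (∑' m, θ m * V m ω))) ∧ AEMeasurable (fun ω => ∑' m, θ m * V m ω) P := by
  have h : ∀ᵐ ω ∂P, Tendsto (fun N => ∑ m ∈ siteBox N, θ m * V m ω) atTop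
      (𝓝 (∑' m, θ m * V m ω)) := by
    filter_upwards [hsum] with ω hω
    have h1 : Summable fun m => θ m * V m ω := by
      refine Summable.of_norm_bounded (hω.mul_left b) fun m => ?_
      rw [norm_mul, Real.norm_eq_abs, Real.norm_eq_abs, abs_of_nonneg (hV0 m ω)]
      exact mul_le_mul_of_nonneg_right (hθ m) (hV0 m ω)
    exact h1.hasSum.comp tendsto_siteBox
  exact ⟨h, aemeasurable_of_tendsto_metrizable_ae atTop
    (fun N => (Finset.measurable_fun_sum (siteBox N) fun m _ => (hV m).const_mul (θ m)).aemeasurable) h⟩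

/-- Dominated convergence: signed partial sums with `|θ m| ≤ b` are bounded by the sums with
constant tilt `b`. -/
theorem integral_exp_tsum (hV : ∀ m, Measurable (V m)) (hV0 : ∀ m ω, 0 ≤ V m ω)
    {ψ : ℝ → ℤ → ℝ}
    (hmgf : ∀ (T : Finset ℤ) (θ : ℤ → ℝ),
      ∫⁻ ω, ENNReal.ofReal (Real.exp (∑ m ∈ T, θ m * V m ω)) ∂P =
      ENNReal.ofReal (Real.exp (∑ m ∈ T, ψ (θ m) m)))
    (hψ : ∀ b : ℝ, ∃ u : ℤ → ℝ, Summable u ∧ ∀ m θ, |θ| ≤ b → |ψ θ m| ≤ u m)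
    {θ : ℤ → ℝ} {b : ℝ} (hθ : ∀ m, |θ m| ≤ b) :
    Integrable (fun ω => Real.exp (∑' m, θ m * V m ω)) P ∧
      ∫ ω, Real.exp (∑' m, θ m * V m ω) ∂P = Real.exp (∑' m, ψ (θ m) m) := by
  have hb : 0 ≤ b := (abs_nonneg _).trans (hθ 0)
  have hsum := ae_summable_of_exp_moments hV hV0 hmgf hψ
  obtain ⟨htend, hYm⟩ := aemeasurable_tsum_of_ae_summable hV hsum hθ hV0
  set G : Ω → ℝ≥0∞ := fun ω => ⨆ N, ENNReal.ofReal (Real.exp (∑ m ∈ siteBox N, b * V m ω)) with hG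
  have hGm : Measurable G :=
    Measurable.iSup fun N => ((Real.measurable_exp.comp (Finset.measurable_fun_sum _ fun m _ =>
      (hV m).const_mul b))).ennreal_ofReal
  have hGfin : ∫⁻ ω, G ω ∂P ≠ ∞ := lintegral_iSup_exp_sum_ne_top hV hV0 hmgf hψ hb
  have hGint : Integrable (fun ω => (G ω).toReal) P :=
    integrable_toReal_of_lintegral_ne_top hGm.aemeasurable hGfin
  have hbound : ∀ᵐ ω ∂P, ∀ N, ‖Real.exp (∑ m ∈ siteBox N, θ m * V m ω)‖ ≤ (G ω).toReal := by
    filter_upwards [ae_lt_top hGm hGfin] with ω hω N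
    rw [Real.norm_eq_abs, abs_of_pos (Real.exp_pos _)]
    have h1 : ENNReal.ofReal (Real.exp (∑ m ∈ siteBox N, b * V m ω)) ≤ G ω :=
      le_iSup (fun N => ENNReal.ofReal (Real.exp (∑ m ∈ siteBox N, b * V m ω))) N
    refine le_trans (Real.exp_le_exp.2 ?_) ((ENNReal.ofReal_le_iff_le_toReal hω.ne).1 h1)
    exact Finset.sum_le_sum fun m _ =>
      mul_le_mul_of_nonneg_right ((le_abs_self _).trans (hθ m)) (hV0 m ω)
  have hmeasN : ∀ N, Measurable fun ω => Real.exp (∑ m ∈ siteBox N, θ m * V m ω) := fun N =>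
    Real.measurable_exp.comp (Finset.measurable_fun_sum _ fun m _ => (hV m).const_mul (θ m))
  have hlim : ∀ᵐ ω ∂P, Tendsto (fun N => Real.exp (∑ m ∈ siteBox N, θ m * V m ω)) atTop
      (𝓝 (Real.exp (∑' m, θ m * V m ω))) := by
    filter_upwards [htend] with ω hω
    exact (Real.continuous_exp.tendsto _).comp hω
  constructor
  · refine hGint.mono' (Real.measurable_exp.comp_aemeasurable hYm).aestronglyMeasurable ?_
    filter_upwards [hbound, hlim] with ω h1 h2
    exact le_of_tendsto h2.norm (Eventually.of_forall h1)
  · have h1 := tendsto_integral_of_dominated_convergence (fun ω => (G ω).toReal)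
      (fun N => (hmeasN N).aestronglyMeasurable) hGint
      (fun N => hbound.mono fun ω h => h N) hlim
    have h2 : ∀ N, ∫ ω, Real.exp (∑ m ∈ siteBox N, θ m * V m ω) ∂P =
        Real.exp (∑ m ∈ siteBox N, ψ (θ m) m) := by
      intro N
      rw [integral_eq_lintegral_of_nonneg_ae (ae_of_all _ fun _ => (Real.exp_pos _).le)
        (hmeasN N).aestronglyMeasurable, hmgf, ENNReal.toReal_ofReal (Real.exp_pos _).le]
    simp_rw [h2] at h1
    obtain ⟨u, hu, hψu⟩ := hψ b
    have h3 : Summable fun m => ψ (θ m) m :=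
      Summable.of_norm_bounded hu fun m => hψu m _ (hθ m)
    exact tendsto_nhds_unique h1
      ((Real.continuous_exp.tendsto _).comp (h3.hasSum.comp tendsto_siteBox))

end InfiniteSum

/-! ### The exponential moments of the current -/

lemma measurable_crossCount {Ω : Type*} [MeasurableSpace Ω] {η : ℤ → Ω → ℕ}
    {X : ℤ → ℕ → ℝ≥0 → Ω → ℤ} (hη : ∀ m, Measurable (η m)) (hX : ∀ m j t, Measurable (X m j t))
    (B K : ℤ) (h : ℝ≥0) (m : ℤ) :
    Measurable fun ω => crossCount B K h (fun m => η m ω) (fun m j u => X m j u ω) m := by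
  have h1 : Measurable fun z : ℕ × Ω => ∑ j ∈ Finset.range z.1,
      (crossSet B (m - K)).indicator (1 : ℤ → ℝ) (X m j h z.2 - X m j 0 z.2) := by
    refine measurable_from_prod_countable_right fun k => ?_
    exact Finset.measurable_fun_sum (Finset.range k) fun j _ =>
      (Measurable.of_discrete (f := (crossSet B (m - K)).indicator (1 : ℤ → ℝ))).comp
        ((hX m j h).sub (hX m j 0))
  exact h1.comp ((hη m).prodMk measurable_id)

/-- When `B` is the integer part of the mean displacement, crossing from distance `|k|` forces a
deviation of at least `|k|` from the mean. -/
lemma crossProb_mul_sq_le {p : PMF ℤ} (hp : HasExpMoments p) {h : ℝ≥0} {B : ℤ}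
    (hB : (B : ℝ) ≤ h * jumpMean p) (hB' : h * jumpMean p < B + 1) (k : ℤ) :
    crossProb p h B k * (k : ℝ) ^ 2 ≤ h * jumpSecondMoment p := by
  have hprob := isProbabilityMeasure_walkLaw p h
  obtain ⟨hL, hmean, hvar⟩ := walkLaw_moments hp h
  rw [← hvar, ← sq_abs (k : ℝ), crossProb]
  refine real_mul_sq_le_variance hL (abs_nonneg _) fun x hx => ?_
  rw [mem_ofPred_eq, hmean]
  unfold crossSet at hx
  split_ifs at hx with hk
  · have h1 : (x : ℝ) ≤ B - k := by exact_mod_cast mem_Iic.1 hx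
    have h2 : (0 : ℝ) < k := by exact_mod_cast hk
    rw [abs_of_pos h2]
    exact le_trans (by linarith) (neg_le_abs _)
  -- Integrality turns the strict inequality into a gain of one, which compensates for `B` being a
  -- rounded-down mean.
  · have h1 : (B : ℝ) - k + 1 ≤ x := by exact_mod_cast Int.add_one_le_iff.2 (mem_Ioi.1 hx)
    have h2 : (k : ℝ) ≤ 0 := by exact_mod_cast not_lt.1 hk
    rw [abs_of_nonpos h2]
    exact le_trans (by linarith) (le_abs_self _)

lemma summable_crossProb {p : PMF ℤ} (hp : HasExpMoments p) {h : ℝ≥0} {B : ℤ}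
    (hB : (B : ℝ) ≤ h * jumpMean p) (hB' : h * jumpMean p < B + 1) :
    Summable fun k => crossProb p h B k := by
  have hs : Summable fun k : ℤ => (h * jumpSecondMoment p) * (1 / (k : ℝ) ^ 2) :=
    ((Real.summable_one_div_int_pow (p := 2)).2 (by norm_num)).mul_left _
  refine hs.of_norm_bounded_eventually ?_
  filter_upwards [(finite_singleton (0 : ℤ)).compl_mem_cofinite] with k hk
  have hk : (k : ℝ) ≠ 0 := by exact_mod_cast hk
  rw [Real.norm_eq_abs, abs_of_nonneg (crossProb_nonneg _ _ _ _), mul_one_div,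
    le_div_iff₀ (by positivity)]
  exact crossProb_mul_sq_le hp hB hB' k

/-- The current is almost surely the signed sum of crossing counts. Reindexing the sites by their
distance from `⌊r √n⌋` removes `r` from the exponential moments. -/
theorem IsWalkSystem.exp_current {Ω : Type*} [MeasurableSpace Ω] {P : Measure Ω}
    [IsProbabilityMeasure P] {p : PMF ℤ} (hp : HasExpMoments p) {ν : Measure ℕ}
    [IsProbabilityMeasure ν] {η : ℤ → Ω → ℕ} {X : ℤ → ℕ → ℝ≥0 → Ω → ℤ}
    (hsys : IsWalkSystem P p ν η X)
    (hν : ∀ θ : ℝ, Integrable (fun k : ℕ => Real.exp (θ * k)) ν)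
    (hg : IsOccupationCGF (occCGF ν)) (n : ℕ) (t : ℝ≥0) (r : ℝ) :
    (∀ᵐ ω ∂P, Summable fun m : ℤ => siteCurrent (jumpMean p)
      (fun m => η m ω) (fun m j u => X m j u ω) n t r m) ∧
    AEMeasurable (fun ω => current (jumpMean p)
      (fun m => η m ω) (fun m j u => X m j u ω) n t r) P ∧
    ∀ l : ℝ, Integrable (fun ω => Real.exp (l * current (jumpMean p)
        (fun m => η m ω) (fun m j u => X m j u ω) n t r)) P ∧
      ∫ ω, Real.exp (l * current (jumpMean p)
        (fun m => η m ω) (fun m j u => X m j u ω) n t r) ∂P =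
      Real.exp (∑' k : ℤ, occCGF ν (bernCGF (crossSign (k : ℝ) * l)
        (crossProb p (n * t) ⌊(n : ℝ) * jumpMean p * t⌋ k))) := by
  set B := ⌊(n : ℝ) * jumpMean p * t⌋ with hBdef
  set K := ⌊r * √(n : ℝ)⌋ with hK
  set h : ℝ≥0 := n * t with hh
  have hhe : (h : ℝ) * jumpMean p = n * jumpMean p * t := by rw [hh]; push_cast; ring
  have hB : (B : ℝ) ≤ h * jumpMean p := by rw [hhe]; exact Int.floor_le _
  have hB' : h * jumpMean p < B + 1 := by rw [hhe]; exact Int.lt_floor_add_one _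
  set V : ℤ → Ω → ℝ := fun m ω => crossCount B K h (fun m => η m ω) (fun m j u => X m j u ω) m with hV
  have hVm : ∀ m, Measurable (V m) := fun m =>
    measurable_crossCount hsys.occ_measurable (fun m j => (hsys.walk m j).measurable) B K h m
  have hV0 : ∀ m ω, 0 ≤ V m ω := fun m ω => crossCount_nonneg _ _ _ _ _ _
  have hmgf := hsys.lintegral_exp_sum hν B K h
  have hψ : ∀ b : ℝ, ∃ u : ℤ → ℝ, Summable u ∧ ∀ m θ, |θ| ≤ b →
      |occCGF ν (bernCGF θ (crossProb p h B (m - K)))| ≤ u m := by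
    intro b
    refine ⟨fun m => deriv (occCGF ν) b * Real.exp b * crossProb p h B (m - K), ?_, fun m θ hθ =>
      hg.abs_comp_bernCGF_le hθ (crossProb_nonneg _ _ _ _) (crossProb_le_one _ _ _ _)⟩
    exact ((Equiv.subRight K).summable_iff.2 (summable_crossProb hp hB hB')).mul_left _
  have hsum := ae_summable_of_exp_moments hVm hV0
    (ψ := fun θ m => occCGF ν (bernCGF θ (crossProb p h B (m - K)))) hmgf hψ
  have hstart : ∀ᵐ ω ∂P, ∀ m j, X m j 0 ω = m :=
    ae_all_iff.2 fun m => ae_all_iff.2 fun j => (hsys.walk m j).start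
  have hsite : ∀ᵐ ω ∂P, ∀ m, siteCurrent (jumpMean p) (fun m => η m ω) (fun m j u => X m j u ω) n t r m
      = crossSign ((m - K : ℤ) : ℝ) * V m ω := by
    filter_upwards [hstart] with ω hω m
    exact siteCurrent_eq _ _ _ _ _ _ _ (hω m)
  have hone : ∀ m, |crossSign ((m - K : ℤ) : ℝ)| ≤ 1 := fun m => (abs_crossSign _).le
  obtain ⟨-, hmeas⟩ := aemeasurable_tsum_of_ae_summable hVm hsum hone hV0
  have hcur : ∀ᵐ ω ∂P, current (jumpMean p) (fun m => η m ω) (fun m j u => X m j u ω) n t r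
      = ∑' m, crossSign ((m - K : ℤ) : ℝ) * V m ω := by
    filter_upwards [hsite] with ω hω
    exact tsum_congr hω
  refine ⟨?_, hmeas.congr (hcur.mono fun ω h => h.symm), fun l => ?_⟩
  · filter_upwards [hsite, hsum] with ω h1 h2
    refine Summable.of_norm_bounded h2 fun m => ?_
    rw [h1, norm_mul, Real.norm_eq_abs, Real.norm_eq_abs, abs_crossSign, one_mul,
      abs_of_nonneg (hV0 m ω)]
  · have hl : ∀ m : ℤ, |crossSign ((m - K : ℤ) : ℝ) * l| ≤ |l| := fun m => (abs_crossSign_mul _ _).le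
    obtain ⟨h1, h2⟩ := integral_exp_tsum hVm hV0
      (ψ := fun θ m => occCGF ν (bernCGF θ (crossProb p h B (m - K)))) hmgf hψ hl
    have he : (fun ω => Real.exp (l * current (jumpMean p)
        (fun m => η m ω) (fun m j u => X m j u ω) n t r)) =ᵐ[P]
        fun ω => Real.exp (∑' m, crossSign ((m - K : ℤ) : ℝ) * l * V m ω) := by
      filter_upwards [hcur] with ω hω
      rw [hω, ← tsum_mul_left]
      congr 1
      exact tsum_congr fun m => by ring
    refine ⟨h1.congr he.symm, ?_⟩
    rw [integral_congr_ae he, h2]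
    congr 1
    exact (Equiv.subRight K).tsum_eq fun k : ℤ => occCGF ν (bernCGF (crossSign (k : ℝ) * l)
      (crossProb p h B k))

/-! ### Riemann sums -/

/-- The ceiling map carries Lebesgue measure to counting measure, as each fibre `(k - 1, k]` has
length one. -/
lemma tsum_int_eq_integral_ceil {f : ℤ → ℝ} (hf : Summable f) : ∑' k, f k = ∫ x : ℝ, f ⌈x⌉ := by
  have hmap : (volume : Measure ℝ).map Int.ceil = Measure.count := by
    refine Measure.ext_of_singleton fun k => ?_
    rw [Measure.map_apply Int.measurable_ceil (measurableSet_singleton k),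
      Int.preimage_ceil_singleton, Real.volume_Ioc, Measure.count_singleton]
    simp
  rw [← integral_map (φ := Int.ceil) Int.measurable_ceil.aemeasurable
    (AEStronglyMeasurable.of_discrete), hmap, integral_countable (integrable_count_iff.2 hf.norm)]
  simp

lemma tsum_int_div_eq_integral_ceil {f : ℤ → ℝ} (hf : Summable f) {a : ℝ} (ha : 0 < a) :
    (∑' k, f k) / a = ∫ y : ℝ, f ⌈a * y⌉ := by
  rw [Measure.integral_comp_mul_left (fun x : ℝ => f ⌈x⌉) a, tsum_int_eq_integral_ceil hf,
    abs_of_pos (inv_pos.2 ha), smul_eq_mul, div_eq_inv_mul]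

/-- Rounding up, unlike rounding down, preserves the side convention: `⌈a y⌉ > 0` exactly when `y >
0`. -/
lemma crossSign_ceil {a : ℝ} (ha : 0 < a) (y : ℝ) :
    crossSign ((⌈a * y⌉ : ℤ) : ℝ) = crossSign y := by
  simp only [crossSign, Int.cast_pos, Int.ceil_pos, mul_pos_iff_of_pos_left ha]

/-! ### The limit of the scaled logarithmic moment generating functions -/

lemma tendsto_scaled_offset (v T y : ℝ) :
    Tendsto (fun n : ℕ => (((⌊(n : ℝ) * v * T⌋ - ⌈√(n : ℝ) * y⌉ : ℤ) : ℝ) - n * (T * v)) / √(n : ℝ))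
      atTop (𝓝 (-y)) := by
  have hsq : Tendsto (fun n : ℕ => √(n : ℝ)) atTop atTop :=
    Real.tendsto_sqrt_atTop.comp tendsto_natCast_atTop_atTop
  have h2 : Tendsto (fun n : ℕ => 2 / √(n : ℝ)) atTop (𝓝 0) := hsq.const_div_atTop 2
  rw [tendsto_iff_dist_tendsto_zero]
  refine squeeze_zero' (Eventually.of_forall fun _ => dist_nonneg) ?_ h2
  filter_upwards [eventually_gt_atTop 0] with n hn
  have hn' : (0 : ℝ) < √(n : ℝ) := Real.sqrt_pos.2 (by exact_mod_cast hn)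
  have e : (((⌊(n : ℝ) * v * T⌋ - ⌈√(n : ℝ) * y⌉ : ℤ) : ℝ) - n * (T * v)) / √(n : ℝ) - -y =
      ((⌊(n : ℝ) * v * T⌋ - n * v * T) - (⌈√(n : ℝ) * y⌉ - √(n : ℝ) * y)) / √(n : ℝ) := by
    push_cast
    field_simp
    ring
  rw [Real.dist_eq, e, abs_div, abs_of_pos hn']
  gcongr
  rw [abs_le]
  have h3 := Int.floor_le ((n : ℝ) * v * T)
  have h4 := Int.lt_floor_add_one ((n : ℝ) * v * T)
  have h5 := Int.le_ceil (√(n : ℝ) * y)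
  have h6 := Int.ceil_lt_add_one (√(n : ℝ) * y)
  constructor <;> linarith

lemma IsRandomWalk.tendsto_crossProb {p : PMF ℤ} (hp : HasExpMoments p)
    {t s : ℝ≥0} (hs : s = (jumpSecondMoment p).toNNReal * t)
    {Ω : Type*} [MeasurableSpace Ω] {P : Measure Ω}
    [IsProbabilityMeasure P] {m : ℤ} {X : ℝ≥0 → Ω → ℤ} (hX : IsRandomWalk P p m X) (hs0 : s ≠ 0)
    (y : ℝ) :
    Tendsto (fun n : ℕ => crossProb p (n * t) ⌊(n : ℝ) * jumpMean p * t⌋ ⌈√(n : ℝ) * y⌉) atTop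
      (𝓝 (gaussTail s y)) := by
  have h := hX.tendsto_walkLaw hp hs hs0 (tendsto_scaled_offset (jumpMean p) t y)
  rw [gaussCDF_neg hs0] at h
  have hset : ∀ n : ℕ, 0 < n → {x : ℤ | (x : ℝ) - n * (t * jumpMean p) ≤ √(n : ℝ) *
      ((((⌊(n : ℝ) * jumpMean p * t⌋ - ⌈√(n : ℝ) * y⌉ : ℤ) : ℝ) - n * (t * jumpMean p)) /
        √(n : ℝ))} = Iic (⌊(n : ℝ) * jumpMean p * t⌋ - ⌈√(n : ℝ) * y⌉) := by
    intro n hn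
    have hn' : (0 : ℝ) < √(n : ℝ) := Real.sqrt_pos.2 (by exact_mod_cast hn)
    ext x
    rw [mem_ofPred_eq, mul_div_cancel₀ _ hn'.ne', sub_le_sub_iff_right, Int.cast_le, mem_Iic]
  by_cases hy : 0 < y
  · rw [gaussTail, if_pos hy]
    refine h.congr' ?_
    filter_upwards [eventually_gt_atTop 0] with n hn
    have hn' : (0 : ℝ) < √(n : ℝ) := Real.sqrt_pos.2 (by exact_mod_cast hn)
    rw [hset n hn, crossProb, crossSet, if_pos (Int.ceil_pos.2 (mul_pos hn' hy))]
  · rw [gaussTail, if_neg hy]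
    have h' := h.const_sub 1
    rw [sub_sub_cancel] at h'
    refine h'.congr' ?_
    filter_upwards [eventually_gt_atTop 0] with n hn
    have hn' : (0 : ℝ) < √(n : ℝ) := Real.sqrt_pos.2 (by exact_mod_cast hn)
    have hprob := isProbabilityMeasure_walkLaw p (n * t)
    rw [hset n hn, crossProb, crossSet, if_neg, ← compl_Iic,
      probReal_compl_eq_one_sub measurableSet_Iic]
    rw [Int.ceil_pos, mul_pos_iff_of_pos_left hn']
    exact hy

/-- A bound uniform in `n`, which provides the integrable majorant for the Riemann sums. -/
lemma crossProb_ceil_le {p : PMF ℤ} (hp : HasExpMoments p) (t : ℝ≥0) {n : ℕ} (hn : 0 < n) (y : ℝ) :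
    crossProb p (n * t) ⌊(n : ℝ) * jumpMean p * t⌋ ⌈√(n : ℝ) * y⌉ ≤
      (3 + 2 * (t * jumpSecondMoment p)) * (1 + y ^ 2)⁻¹ := by
  have hn' : (0 : ℝ) < n := by exact_mod_cast hn
  have hn1 : (1 : ℝ) ≤ n := by exact_mod_cast hn
  have he : ((n * t : ℝ≥0) : ℝ) * jumpMean p = n * jumpMean p * t := by push_cast; ring
  have h1 := crossProb_mul_sq_le hp (h := n * t) (B := ⌊(n : ℝ) * jumpMean p * t⌋)
    (by rw [he]; exact Int.floor_le _) (by rw [he]; exact Int.lt_floor_add_one _) ⌈√(n : ℝ) * y⌉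
  have hq0 := crossProb_nonneg p (n * t) ⌊(n : ℝ) * jumpMean p * t⌋ ⌈√(n : ℝ) * y⌉
  have hq1 := crossProb_le_one p (n * t) ⌊(n : ℝ) * jumpMean p * t⌋ ⌈√(n : ℝ) * y⌉
  set q := crossProb p (n * t) ⌊(n : ℝ) * jumpMean p * t⌋ ⌈√(n : ℝ) * y⌉
  set k := ⌈√(n : ℝ) * y⌉
  have hk1 : √(n : ℝ) * y ≤ k := Int.le_ceil _
  have hk2 : (k : ℝ) < √(n : ℝ) * y + 1 := Int.ceil_lt_add_one _
  -- Rounding moves `√n y` by less than one, whence the constant `2`. As `n ≥ 1`, the additive `2`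
  -- is absorbed after division by `n`; adding `q ≤ 1` produces the `3`.
  have hy : n * y ^ 2 ≤ 2 * (k : ℝ) ^ 2 + 2 := by
    have : n * y ^ 2 = (√(n : ℝ) * y) ^ 2 := by rw [mul_pow, Real.sq_sqrt hn'.le]
    rw [this]
    nlinarith [sq_nonneg ((k : ℝ) + (k - √(n : ℝ) * y))]
  have h2 : n * (q * y ^ 2) ≤ n * (2 * (t * jumpSecondMoment p) + 2) := by
    have e : ((n * t : ℝ≥0) : ℝ) * jumpSecondMoment p = n * (t * jumpSecondMoment p) := by
      push_cast; ring
    rw [e] at h1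
    nlinarith [mul_le_mul_of_nonneg_left hy hq0]
  have h3 := le_of_mul_le_mul_left h2 hn'
  rw [← div_eq_mul_inv, le_div_iff₀ (by positivity)]
  linarith

/-- The scaled sum equals an integral of a step function in `y`, to which dominated convergence
applies. -/
theorem IsRandomWalk.tendsto_tsum_div_sqrt {p : PMF ℤ} (hp : HasExpMoments p)
    {t s : ℝ≥0} (hs : s = (jumpSecondMoment p).toNNReal * t)
    {Ω : Type*} [MeasurableSpace Ω] {P : Measure Ω}
    [IsProbabilityMeasure P] {m : ℤ} {X : ℝ≥0 → Ω → ℤ} (hX : IsRandomWalk P p m X) (hs0 : s ≠ 0)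
    {g : ℝ → ℝ} (hg : IsOccupationCGF g) (l : ℝ) :
    Tendsto (fun n : ℕ => (∑' k : ℤ, g (bernCGF (crossSign (k : ℝ) * l)
      (crossProb p (n * t) ⌊(n : ℝ) * jumpMean p * t⌋ k))) / √(n : ℝ)) atTop (𝓝 (Lam g s l)) := by
  set q : ℕ → ℤ → ℝ := fun n k => crossProb p (n * t) ⌊(n : ℝ) * jumpMean p * t⌋ k with hq
  have hbd : ∀ (n : ℕ) (k : ℤ), |g (bernCGF (crossSign (k : ℝ) * l) (q n k))| ≤
      deriv g |l| * Real.exp |l| * q n k := fun n k =>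
    hg.abs_comp_bernCGF_le (abs_crossSign_mul _ _).le (crossProb_nonneg _ _ _ _)
      (crossProb_le_one _ _ _ _)
  have hC : 0 ≤ deriv g |l| * Real.exp |l| := mul_nonneg (hg.deriv_pos _).le (Real.exp_pos _).le
  have hdom : Tendsto (fun n : ℕ => ∫ y : ℝ, g (bernCGF (crossSign y * l) (q n ⌈√(n : ℝ) * y⌉)))
      atTop (𝓝 (Lam g s l)) := by
    refine tendsto_integral_filter_of_dominated_convergence
      (fun y => deriv g |l| * Real.exp |l| *
        ((3 + 2 * (t * jumpSecondMoment p)) * (1 + y ^ 2)⁻¹)) ?_ ?_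
      ((integrable_inv_one_add_sq.const_mul _).const_mul _) (ae_of_all _ fun y => ?_)
    · refine Eventually.of_forall fun n => Measurable.aestronglyMeasurable ?_
      refine hg.differentiable.continuous.measurable.comp (measurable_bernCGF.comp
        ((measurable_crossSign.mul_const l).prodMk ?_))
      exact (Measurable.of_discrete (f := q n)).comp
        (Int.measurable_ceil.comp (measurable_const_mul _))
    · filter_upwards [eventually_gt_atTop 0] with n hn
      refine ae_of_all _ fun y => ?_
      have hn' : (0 : ℝ) < √(n : ℝ) := Real.sqrt_pos.2 (by exact_mod_cast hn)
      have h1 := hbd n ⌈√(n : ℝ) * y⌉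
      rw [crossSign_ceil hn'] at h1
      exact h1.trans (mul_le_mul_of_nonneg_left (crossProb_ceil_le hp t hn y) hC)
    · rw [Zfun_eq]
      refine ((hg.differentiable.continuous.tendsto _).comp ?_)
      have hcont : ContinuousAt (bernCGF (crossSign y * l)) (gaussTail s y) :=
        (continuousOn_bernCGF _).continuousAt
          (Icc_mem_nhds (gaussTail_pos hs0 y) (gaussTail_lt_one hs0 y))
      exact hcont.tendsto.comp (hX.tendsto_crossProb hp hs hs0 y)
  refine hdom.congr' ?_
  filter_upwards [eventually_gt_atTop 0] with n hn
  have hn' : (0 : ℝ) < √(n : ℝ) := Real.sqrt_pos.2 (by exact_mod_cast hn)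
  have he : ((n * t : ℝ≥0) : ℝ) * jumpMean p = n * jumpMean p * t := by push_cast; ring
  have hsum : Summable fun k : ℤ => g (bernCGF (crossSign (k : ℝ) * l) (q n k)) :=
    Summable.of_norm_bounded ((summable_crossProb hp (h := n * t)
      (B := ⌊(n : ℝ) * jumpMean p * t⌋) (by rw [he]; exact Int.floor_le _)
      (by rw [he]; exact Int.lt_floor_add_one _)).mul_left _) (hbd n)
  rw [tsum_int_div_eq_integral_ceil hsum hn']
  refine integral_congr_ae (ae_of_all _ fun y => ?_)
  simp only [crossSign_ceil hn']

/-! ### The occupation generating function -/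

/-- The generating function is analytic on the whole line. Its second derivative is the variance of
a tilted law, hence nonnegative, and its first is a tilted mean, positive because `ν` charges the
positive integers. -/
lemma isOccupationCGF_occCGF {ν : Measure ℕ} [IsProbabilityMeasure ν]
    (hν : ∀ θ : ℝ, Integrable (fun k : ℕ => Real.exp (θ * k)) ν) (hν0 : ν {0} ≠ 1) :
    IsOccupationCGF (occCGF ν) := by
  set c : ℕ → ℝ := fun k => (k : ℝ) with hc
  have heq : occCGF ν = cgf c ν := rfl
  have hset : integrableExpSet c ν = univ := eq_univ_of_forall hν
  have hmem : ∀ z, z ∈ interior (integrableExpSet c ν) := fun z => by simp [hset]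
  have han : AnalyticOnNhd ℝ (cgf c ν) univ := by
    have := analyticOnNhd_cgf (X := c) (μ := ν)
    rwa [hset, interior_univ] at this
  rw [heq]
  refine ⟨cgf_zero, fun z => (analyticAt_cgf (hmem z)).differentiableAt,
    continuousOn_univ.1 han.deriv.continuousOn, ?_, fun z => ?_⟩
  · refine monotone_of_deriv_nonneg (fun z => (han.deriv z (mem_univ z)).differentiableAt)
      fun z => ?_
    have h := variance_tilted_mul (hmem z)
    rw [iteratedDeriv_succ, iteratedDeriv_one] at h
    rw [← h]
    exact variance_nonneg _ _
  · rw [deriv_cgf (hmem z)]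
    refine div_pos ?_ (mgf_pos (hν z))
    have hint := integrable_pow_mul_exp_of_mem_interior_integrableExpSet (hmem z) 1
    simp only [pow_one] at hint
    rw [integral_pos_iff_support_of_nonneg
      (fun k => mul_nonneg (Nat.cast_nonneg k) (Real.exp_pos _).le) hint]
    have hsupp : Function.support (fun k : ℕ => c k * Real.exp (z * c k)) = {0}ᶜ := by
      ext k
      simp [hc, Real.exp_ne_zero]
    rw [hsupp, pos_iff_ne_zero]
    intro h
    exact hν0 ((prob_compl_eq_zero_iff (measurableSet_singleton 0)).1 h)

end CurrentLDP

end

theorem theorem2p2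
    -- jump kernel, with exponential moments near zero, not concentrated at zero
    (p : PMF ℤ)
    (hp_exp : ∃ δ : ℝ, 0 < δ ∧ ∀ θ : ℝ, |θ| ≤ δ →
      Summable fun x : ℤ => Real.exp (θ * x) * (p x).toReal)
    (hp_ne : p 0 ≠ 1)
    -- occupation law, with all exponential moments, not concentrated at zero
    (ν : Measure ℕ) [IsProbabilityMeasure ν]
    (hν_exp : ∀ θ : ℝ, Integrable (fun k : ℕ => Real.exp (θ * k)) ν)
    (hν_ne : ν {0} ≠ 1)
    -- for each `n`, a system of independent walks with i.i.d. initial occupations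
    {Ω : ℕ → Type*} [∀ n, MeasurableSpace (Ω n)] (P : ∀ n, Measure (Ω n))
    [∀ n, IsProbabilityMeasure (P n)]
    (η : ∀ n, ℤ → Ω n → ℕ) (X : ∀ n, ℤ → ℕ → ℝ≥0 → Ω n → ℤ)
    (hsys : ∀ n, CurrentLDP.IsWalkSystem (P n) p ν (η n) (X n))
    (r : ℝ) (t : ℝ≥0) (ht : 0 < t)
    (Y : ∀ n, Ω n → ℝ)
    (hY : ∀ n ω, Y n ω = CurrentLDP.current (CurrentLDP.jumpMean p)
      (fun m => η n m ω) (fun m j u => X n m j u ω) n t r)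
    (γ : ℝ → ℝ) (hγ : γ = CurrentLDP.occCGF ν)
    (s : ℝ≥0) (hs : s = (CurrentLDP.jumpSecondMoment p).toNNReal * t) :
    -- the series defining the current converges (absolutely) almost surely
    (∀ n, ∀ᵐ ω ∂(P n), Summable fun m : ℤ => CurrentLDP.siteCurrent (CurrentLDP.jumpMean p)
      (fun m => η n m ω) (fun m j u => X n m j u ω) n t r m) ∧
    -- `Λ` is finite and differentiable everywhere
    (∀ l : ℝ, Integrable fun y : ℝ => γ (CurrentLDP.Zfun s l y)) ∧
    Differentiable ℝ (CurrentLDP.Lam γ s) ∧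
    -- the equation `x = Λ'(a)` has exactly one solution `a = α x`
    ∃ α : ℝ → ℝ, (∀ x a : ℝ, HasDerivAt (CurrentLDP.Lam γ s) x a ↔ a = α x) ∧
      -- `γ*` is finite where it is used and the integrals `I₁`, `I₂` converge
      (∀ x y : ℝ, BddAbove (Set.range fun θ : ℝ =>
        θ * deriv γ (CurrentLDP.Zfun s (α x) y) - γ θ)) ∧
      (∀ x : ℝ, Integrable (CurrentLDP.density1 γ s (α x))) ∧
      (∀ x : ℝ, Integrable (CurrentLDP.density2 γ s (α x))) ∧
      -- `I = I₁ + I₂` is the convex dual of `Λ`, a good strictly convex rate function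
      (∀ x : ℝ, IsLUB (Set.range fun l : ℝ => l * x - CurrentLDP.Lam γ s l)
        (CurrentLDP.rateAtTilt γ s (α x))) ∧
      CurrentLDP.IsGoodRate (fun x => CurrentLDP.rateAtTilt γ s (α x)) ∧
      StrictConvexOn ℝ Set.univ (fun x => CurrentLDP.rateAtTilt γ s (α x)) ∧
      -- the large deviation principle with normalization `√n`
      CurrentLDP.SatisfiesLDP P (fun n ω => Y n ω / √(n : ℝ)) (fun n => √(n : ℝ))
        (fun x => CurrentLDP.rateAtTilt γ s (α x)) := by
  have hp : CurrentLDP.HasExpMoments p := hp_exp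
  have hg : CurrentLDP.IsOccupationCGF γ := hγ ▸ CurrentLDP.isOccupationCGF_occCGF hν_exp hν_ne
  have hs0 : s ≠ 0 := by
    rw [hs]
    exact mul_ne_zero (Real.toNNReal_pos.2 (CurrentLDP.jumpSecondMoment_pos hp hp_ne)).ne' ht.ne'
  have hcur := fun n => (hsys n).exp_current hp hν_exp (hγ ▸ hg) n t r
  have hΛ := CurrentLDP.hasDerivAt_Lam hg hs0
  have hD := CurrentLDP.lamDeriv_strictMono hg hs0
  have hsurj := CurrentLDP.lamDeriv_surjective hg hs0
  obtain ⟨α, hα⟩ : ∃ α : ℝ → ℝ, ∀ x, CurrentLDP.lamDeriv γ s (α x) = x :=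
    ⟨Function.surjInv hsurj, Function.surjInv_eq hsurj⟩
  have hrate : ∀ x, CurrentLDP.rateAtTilt γ s (α x) = α x * x - CurrentLDP.Lam γ s (α x) := by
    intro x
    rw [CurrentLDP.rateAtTilt_eq hg hs0, hα]
  refine ⟨fun n => (hcur n).1, CurrentLDP.integrable_comp_Zfun hg hs0,
    fun l => (hΛ l).differentiableAt, α, fun x a => ⟨fun h => ?_, ?_⟩, fun x y => hg.bddAbove _,
    fun x => CurrentLDP.integrable_density1 hg hs0 _, fun x => CurrentLDP.integrable_density2 hg hs0 _,
    fun x => ?_, ?_, ?_, ?_⟩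
  · exact hD.injective (by rw [hα, h.unique (hΛ a)])
  · rintro rfl
    have := hΛ (α x)
    rwa [hα] at this
  · rw [hrate]
    exact CurrentLDP.isLUB_dual hΛ hD hα x
  · simp_rw [hrate]
    exact CurrentLDP.isGoodRate_dual hΛ hD hα (CurrentLDP.Lam_zero hg s)
  · simp_rw [hrate]
    exact CurrentLDP.strictConvexOn_dual hΛ hD hα
  · simp_rw [hrate]
    have hYeq : ∀ n, Y n = fun ω => CurrentLDP.current (CurrentLDP.jumpMean p)
        (fun m => η n m ω) (fun m j u => X n m j u ω) n t r := fun n => funext (hY n)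
    have hexp : ∀ n (l : ℝ), (fun ω => Real.exp (l * (Y n ω / √(n : ℝ)))) =
        fun ω => Real.exp (l / √(n : ℝ) * Y n ω) := fun n l => by
      ext ω
      congr 1
      ring
    refine CurrentLDP.satisfiesLDP_of_tendsto_cgf (fun n => ?_)
      (Real.tendsto_sqrt_atTop.comp tendsto_natCast_atTop_atTop) (fun n l => ?_) (fun l => ?_)
      hΛ hD hα
    · rw [hYeq]
      exact (hcur n).2.1.div_const _
    · rw [hexp, hYeq]
      exact ((hcur n).2.2 _).1
    -- Any walk of any system will do, since the limit statement involves only the common law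
    -- `walkLaw`.
    · have hlim := ((hsys 0).walk 0 0).tendsto_tsum_div_sqrt hp hs hs0 hg l
      refine hlim.congr' ?_
      filter_upwards [eventually_gt_atTop 0] with n hn
      have hn' : √(n : ℝ) ≠ 0 := (Real.sqrt_pos.2 (by exact_mod_cast hn)).ne'
      simp only [Function.comp_apply]
      -- The parameter `√n l` for `Y n / √n` is the parameter `l` for `Y n`.
      rw [cgf, mgf, hexp, mul_div_cancel_left₀ _ hn', hYeq, ((hcur n).2.2 l).2, Real.log_exp, hγ]
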